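/- Let $M,K,R\ge 1$, let $\mathcal D_1,\dots,\mathcal D_M$ be probability distributions on a sample space, let $f(\cdot;\xi):\mathbb R^d\to\mathbb R$, and put $F_m(w)=\mathbb E_{\xi\sim\mathcal D_m}f(w;\xi)$ and $F=\frac1M\sum_{m=1}^M F_m$. Suppose that - for every $\xi$, $f(\cdot;\xi)$ is convex and $H$-smooth (differentiable with $H$-Lipschitz gradient, $H\ge 0$), and $\mathbb E_{\xi\sim\mathcal D_m}[\nabla f(w;\xi)]=\nabla F_m(w)$ for all $w$ and $m$; - $F_*\in\mathbb R$ satisfies $F(w)\ge F_*$ for all $w\in\mathbb R^d$ (a minimizer need not exist); - $\mathbb E_{\xi\sim\mathcal D_m}\|\nabla f(w;\xi)-\nabla F_m(w)\|^2\le\sigma^2$ for all $w$ and $m$, where $\sigma\ge0$; - $\|\nabla F_m(w)-\nabla F(w)\|\le\zeta$ for all $w$ and $m$, where $\zeta\ge0$. Local SGD with step size $\eta$, started at $\bar w_0\in\mathbb R^d$, sets for $r=0,\dots,R-1$: $w^m_{r,0}=\bar w_r$, $w^m_{r,k+1}=w^m_{r,k}-\eta\nabla f(w^m_{r,k};\xi^m_{r,k})$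 for $0\le k<K$ and $1\le m\le M$, and $\bar w_{r+1}=\frac1M\sum_{m=1}^M w^m_{r,K}$, where the samples $\xi^m_{r,k}\sim\mathcal D_m$ are jointly independent. Its output is the uniform average $\hat w=\frac1{KR}\sum_{r=0}^{R-1}\sum_{k=0}^{K-1}\frac1M\sum_{m=1}^M w^m_{r,k}$. Then there is an absolute constant $C$ such that, for every comparator $u\in\mathbb R^d$, with $B=\|\bar w_0-u\|$, there is a step size $\eta$ (with $\eta>0$ if $u\ne\bar w_0$, and $\eta\ge0$ if $u=\bar w_0$) for which $F(\hat w)$ is integrable and $$\mathbb E\left[F(\hat w)-F_*\right]\le C\left(\frac{HB^2}{KR}+\frac{\sigma B}{\sqrt{MKR}}+\frac{(H\zeta^2B^4)^{1/3}}{R^{2/3}}+\frac{(H\sigma^2B^4)^{1/3}}{K^{1/3}R^{2/3}}+\big(F(u)-F_*\big)\right).$$ The constant $C$ does not depend on $d,M,K,R,H,\sigma,\zeta,F_*,f,\mathcal D_1,\dots,\mathcal D_M,\bar w_0$ or $u$. -/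

import Mathlib

open MeasureTheory ProbabilityTheory

noncomputable section

namespace LocalSGD

/-- The parameter space `ℝ^d` with its Euclidean norm. -/
abbrev Vec (d : ℕ) : Type := EuclideanSpace ℝ (Fin d)

/-- `g` is `H`-smooth: differentiable everywhere, with an `H`-Lipschitz gradient. -/
def IsSmooth {d : ℕ} (H : ℝ) (g : Vec d → ℝ) : Prop :=
  Differentiable ℝ g ∧ ∀ x y : Vec d, ‖gradient g x - gradient g y‖ ≤ H * ‖x - y‖

/-- The stochastic gradient `∇f(w; z)`, the gradient being taken in the first argument. -/
def stochGrad {d : ℕ} {Ξ : Type*} (f : Vec d → Ξ → ℝ) (w : Vec d) (z : Ξ) : Vec d :=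
  gradient (fun v => f v z) w

/-- The local objective `F_m(w) = E_{z ∼ D_m} f(w; z)` of a client with data distribution `Dm`. -/
def localObj {d : ℕ} {Ξ : Type*} [MeasurableSpace Ξ] (Dm : Measure Ξ) (f : Vec d → Ξ → ℝ)
    (w : Vec d) : ℝ :=
  ∫ z, f w z ∂Dm

/-- The global objective `F(w) = (1/M) ∑_m F_m(w)`. -/
def globalObj {d M : ℕ} {Ξ : Type*} [MeasurableSpace Ξ] (D : Fin M → Measure Ξ)
    (f : Vec d → Ξ → ℝ) (w : Vec d) : ℝ :=
  (1 / (M : ℝ)) * ∑ m, localObj (D m) f w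

/-- The standing assumptions on the problem: `f(·; z)` is convex and `H`-smooth for every `z`,
the objectives are well-defined expectations, `Fstar` is a lower bound of `F` (not necessarily
attained, nor the infimum), and stochastic gradients are unbiased. -/
structure CommonAssumption {d M : ℕ} {Ξ : Type*} [MeasurableSpace Ξ] (D : Fin M → Measure Ξ)
    (f : Vec d → Ξ → ℝ) (H Fstar : ℝ) : Prop where
  convex : ∀ z, ConvexOn ℝ Set.univ (fun w => f w z)
  smooth : ∀ z, IsSmooth H (fun w => f w z)
  measurable : ∀ w, Measurable (f w)
  integrable : ∀ m w, Integrable (f w) (D m)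
  lower_bound : ∀ w, Fstar ≤ globalObj D f w
  integrable_grad : ∀ m w, Integrable (stochGrad f w) (D m)
  unbiased : ∀ m w, ∫ z, stochGrad f w z ∂(D m) = gradient (localObj (D m) f) w

/-- Global bound `σ²` on the variance of the stochastic gradients. -/
def GlobalNoise {d M : ℕ} {Ξ : Type*} [MeasurableSpace Ξ] (D : Fin M → Measure Ξ)
    (f : Vec d → Ξ → ℝ) (σ : ℝ) : Prop :=
  ∀ (w : Vec d) (m : Fin M),
    Integrable (fun z => ‖stochGrad f w z - gradient (localObj (D m) f) w‖ ^ 2) (D m) ∧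
      ∫ z, ‖stochGrad f w z - gradient (localObj (D m) f) w‖ ^ 2 ∂(D m) ≤ σ ^ 2

/-- Global bound `ζ` on the dissimilarity of the local gradients. -/
def GlobalHeterogeneity {d M : ℕ} {Ξ : Type*} [MeasurableSpace Ξ] (D : Fin M → Measure Ξ)
    (f : Vec d → Ξ → ℝ) (ζ : ℝ) : Prop :=
  ∀ (w : Vec d) (m : Fin M),
    ‖gradient (localObj (D m) f) w - gradient (globalObj D f) w‖ ≤ ζ

/-- The local iterates of one client in one round: `w_0 = w`,
`w_{k+1} = w_k - η ∇f(w_k; z_k)`. -/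
def localIterate {d : ℕ} {Ξ : Type*} (f : Vec d → Ξ → ℝ) (η : ℝ) (z : ℕ → Ξ) (w : Vec d) :
    ℕ → Vec d
  | 0 => w
  | k + 1 => localIterate f η z w k - η • stochGrad f (localIterate f η z w k) (z k)

/-- The averaged iterates at the round boundaries, with `K` local steps per round. The sample used
by client `m` in local step `k` of round `r` is `s r k m`. -/
def roundIterate {d M : ℕ} {Ξ : Type*} (f : Vec d → Ξ → ℝ) (η : ℝ) (K : ℕ)
    (s : ℕ → ℕ → Fin M → Ξ) (w₀ : Vec d) : ℕ → Vec d
  | 0 => w₀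
  | r + 1 => (1 / (M : ℝ)) •
      ∑ m, localIterate f η (fun k => s r k m) (roundIterate f η K s w₀ r) K

/-- The output of Local SGD with `R` rounds, `K` local steps, step size `η`, averaging weights `α`
and samples `s`, started at `w₀`. -/
def localSGD {d M : ℕ} {Ξ : Type*} (f : Vec d → Ξ → ℝ) (η : ℝ) (K R : ℕ) (α : ℕ → ℕ → ℝ)
    (s : ℕ → ℕ → Fin M → Ξ) (w₀ : Vec d) : Vec d :=
  ∑ r ∈ Finset.range R, ∑ k ∈ Finset.range K, α r k • ((1 / (M : ℝ)) •
    ∑ m, localIterate f η (fun j => s r j m) (roundIterate f η K s w₀ r) k)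

/-- The samples of the first `R` rounds of `K` local steps are jointly independent (over rounds,
steps and clients), and each sample of client `m` has law `D m`. -/
def IsSampling {M : ℕ} {Ξ Ω : Type*} [MeasurableSpace Ξ] [MeasurableSpace Ω] (K R : ℕ)
    (D : Fin M → Measure Ξ) (P : Measure Ω) (ξ : ℕ → ℕ → Fin M → Ω → Ξ) : Prop :=
  (∀ r < R, ∀ k < K, ∀ m, HasLaw (ξ r k m) (D m) P) ∧
    iIndepFun (fun (i : Fin R × Fin K × Fin M) => ξ i.1 i.2.1 i.2.2) P

end LocalSGD

end

/-! Track y, the mean of the clients' parameters. It moves by -η times the averaged stochastic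
gradient, and averaging at the end of a round leaves it unchanged, so E‖y - u‖² telescopes over all
K·R steps. The argument needs two estimates.

Descent (`norm_clientMean_step_sq_le`): convexity of each F_m towards u and smoothness towards y
bound the inner product with the averaged gradient g by F(u) - F(y), up to H times the consensus
error V. Smoothness with the lower bound F_* gives ‖g‖² = O(H(F(y) - F_*) + H²V). For 8ηH ≤ 1 a step
gains η(F(y) - F_*) and pays 2η(F(u) - F_*) + 3ηHV. Only a lower bound is used, so no minimizer is
needed, and an arbitrary u costs its own suboptimality. Independence across clients leaves noise
η²σ²/M.

Drift (`integral_norm_clients_sub_sq_le`): an exact step along ∇F is nonexpansive, so in one step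
two clients separate by at most 2ηζ plus centred noise. Young's inequality with weight 1/K and (1 +
1/K)^K ≤ 3 give E V = O(η²(K²ζ² + Kσ²)) within a round.

Summing, dividing by ηKR and applying Jensen gives `IsRun.integral_localSGD_le`; `exists_stepSize`
then balances the terms. Fresh samples are independent of the current iterates, so one-step bounds
for frozen parameters integrate to bounds along the run. -/

namespace LocalSGD

open scoped InnerProductSpace

/-! ### Convexity and smoothness as two-sided quadratic bounds -/

section Deterministic

variable {E : Type*} [NormedAddCommGroup E] [InnerProductSpace ℝ E]

/-- `F` lies above its linearisations with slopes `G`, and below them up to `L / 2 * ‖v - w‖ ^ 2`: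
convexity and `L`-smoothness in integrated form. -/
def QuadBounds (L : ℝ) (F : E → ℝ) (G : E → E) : Prop :=
  ∀ w v, F w + ⟪G w, v - w⟫_ℝ ≤ F v ∧ F v ≤ F w + ⟪G w, v - w⟫_ℝ + L / 2 * ‖v - w‖ ^ 2

/-- First-order characterisation of convexity. -/
theorem add_inner_gradient_le [CompleteSpace E] {F : E → ℝ} (hc : ConvexOn ℝ Set.univ F)
    {w g : E} (hg : HasGradientAt F g w) (v : E) : F w + ⟪g, v - w⟫_ℝ ≤ F v := by
  -- On the line through `w` and `v`, the derivative at 0 of a convex function is at most its slope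
  -- over [0, 1].
  have hline : ConvexOn ℝ Set.univ (F ∘ AffineMap.lineMap (k := ℝ) w v) := by
    simpa using hc.comp_affineMap (AffineMap.lineMap (k := ℝ) w v)
  have hd : HasDerivAt (F ∘ AffineMap.lineMap (k := ℝ) w v) ⟪g, v - w⟫_ℝ 0 := by
    have h1 : HasDerivAt (AffineMap.lineMap (k := ℝ) w v) (v - w) (0 : ℝ) :=
      AffineMap.hasDerivAt_lineMap
    have h2 : HasFDerivAt F (InnerProductSpace.toDual ℝ E g)
        (AffineMap.lineMap (k := ℝ) w v (0 : ℝ)) := by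
      simpa using hasGradientAt_iff_hasFDerivAt.1 hg
    simpa using h2.comp_hasDerivAt (0 : ℝ) h1
  have h := hline.le_slope_of_hasDerivAt (Set.mem_univ 0) (Set.mem_univ 1) one_pos hd
  simp [slope_def_field] at h
  linarith

/-- A convex function with `H`-Lipschitz gradient has quadratic bounds. The constant `2 * H` comes
from applying the first-order inequality at both end points. -/
theorem quadBounds_of_convexOn [CompleteSpace E] {F : E → ℝ} {H : ℝ}
    (hc : ConvexOn ℝ Set.univ F) (hd : Differentiable ℝ F)
    (hL : ∀ x y, ‖gradient F x - gradient F y‖ ≤ H * ‖x - y‖) :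
    QuadBounds (2 * H) F (gradient F) := by
  intro w v
  have hw := add_inner_gradient_le hc (hd w).hasGradientAt v
  have hv := add_inner_gradient_le hc (hd v).hasGradientAt w
  refine ⟨hw, ?_⟩
  have h1 : ⟪gradient F v - gradient F w, v - w⟫_ℝ ≤ H * ‖v - w‖ * ‖v - w‖ :=
    (real_inner_le_norm _ _).trans
      (mul_le_mul_of_nonneg_right (hL v w) (norm_nonneg _))
  rw [inner_sub_left] at h1
  have h2 : ⟪gradient F v, w - v⟫_ℝ = - ⟪gradient F v, v - w⟫_ℝ := by
    rw [← inner_neg_right, neg_sub]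
  nlinarith

namespace QuadBounds

variable {L : ℝ} {F : E → ℝ} {G : E → E}

/-- The linearisation error lies between 0 and a multiple of ‖v - w‖², hence is little-o. Thus any
slope field satisfying the bounds is the gradient. -/
theorem hasGradientAt [CompleteSpace E] (h : QuadBounds L F G) (w : E) :
    HasGradientAt F (G w) w := by
  rw [hasGradientAt_iff_isLittleO]
  have h1 : (fun v => F v - F w - ⟪G w, v - w⟫_ℝ) =O[nhds w] fun v => ‖v - w‖ ^ 2 := by
    refine Asymptotics.IsBigO.of_bound (L / 2) (Filter.Eventually.of_forall fun v => ?_)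
    have := h w v
    rw [Real.norm_of_nonneg (by linarith), Real.norm_of_nonneg (by positivity)]
    linarith
  refine h1.trans_isLittleO ?_
  have h2 : (fun v : E => ‖v - w‖) =o[nhds w] fun _ => (1 : ℝ) := by
    rw [Asymptotics.isLittleO_one_iff]
    have : Continuous fun v : E => ‖v - w‖ := by fun_prop
    simpa using this.tendsto w
  have h3 := h2.mul_isBigO (Asymptotics.isBigO_refl (fun v : E => ‖v - w‖) (nhds w))
  refine (h3.congr (fun v => by ring) (fun v => by rw [one_mul])).trans_isBigO ?_
  exact (Asymptotics.isBigO_refl (fun v : E => v - w) (nhds w)).norm_left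

theorem continuous [CompleteSpace E] (h : QuadBounds L F G) : Continuous F :=
  continuous_iff_continuousAt.2 fun w =>
    (hasGradientAt_iff_hasFDerivAt.1 (h.hasGradientAt w)).continuousAt

theorem convexOn (h : QuadBounds L F G) : ConvexOn ℝ Set.univ F := by
  refine ⟨convex_univ, fun x _ y _ a b ha hb hab => ?_⟩
  set z := a • x + b • y with hz
  have hx := (h z x).1
  have hy := (h z y).1
  have h0 : a * ⟪G z, x - z⟫_ℝ + b * ⟪G z, y - z⟫_ℝ = 0 := by
    rw [← real_inner_smul_right, ← real_inner_smul_right, ← inner_add_right]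
    have : a • (x - z) + b • (y - z) = 0 := by
      rw [smul_sub, smul_sub, sub_add_sub_comm, ← add_smul, hab, one_smul, sub_self]
    rw [this, inner_zero_right]
  have h1 := mul_le_mul_of_nonneg_left hx ha
  have h2 := mul_le_mul_of_nonneg_left hy hb
  have h3 : a * F z + b * F z = F z := by rw [← add_mul, hab, one_mul]
  simp only [smul_eq_mul]
  linarith

/-- The strengthened first-order inequality for smooth convex functions. -/
theorem add_norm_sq_le (h : QuadBounds L F G) (hL : 0 < L) (x y : E) :
    F x + ⟪G x, y - x⟫_ℝ + 1 / (2 * L) * ‖G y - G x‖ ^ 2 ≤ F y := by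
  set g := G y - G x with hg
  -- The test point minimises the quadratic upper bound at `y` minus the linear lower bound at `x`.
  have h1 := (h x (y - (1 / L) • g)).1
  have h2 := (h y (y - (1 / L) • g)).2
  have e1 : y - (1 / L) • g - y = -((1 / L) • g) := by abel
  have e2 : y - (1 / L) • g - x = (y - x) - (1 / L) • g := by abel
  rw [e1, norm_neg, norm_smul, inner_neg_right, inner_smul_right] at h2
  rw [e2, inner_sub_right, inner_smul_right] at h1
  have e3 : ⟪G y, g⟫_ℝ - ⟪G x, g⟫_ℝ = ‖g‖ ^ 2 := by
    rw [← inner_sub_left, ← hg, real_inner_self_eq_norm_sq]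
  have e4 : L / 2 * (‖1 / L‖ * ‖g‖) ^ 2 = 1 / (2 * L) * ‖g‖ ^ 2 := by
    rw [Real.norm_of_nonneg (by positivity)]; field_simp
  have e5 : 1 / L * ‖g‖ ^ 2 = 2 * (1 / (2 * L) * ‖g‖ ^ 2) := by field_simp
  rw [e4] at h2
  rw [← e3, mul_sub] at e5
  rw [e3] at e5
  linarith

/-- Cocoercivity of the gradient. -/
theorem norm_sub_sq_le_inner (h : QuadBounds L F G) (hL : 0 < L) (x y : E) :
    ‖G x - G y‖ ^ 2 ≤ L * ⟪G x - G y, x - y⟫_ℝ := by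
  have h1 := h.add_norm_sq_le hL x y
  have h2 := h.add_norm_sq_le hL y x
  rw [norm_sub_rev] at h1
  have e : ⟪G x, y - x⟫_ℝ = -⟪G x, x - y⟫_ℝ := by rw [← inner_neg_right, neg_sub]
  rw [inner_sub_left]
  have e2 : ‖G x - G y‖ ^ 2 = L * (2 * (1 / (2 * L) * ‖G x - G y‖ ^ 2)) := by field_simp
  rw [e2]
  exact mul_le_mul_of_nonneg_left (by linarith) hL.le

theorem norm_sub_le (h : QuadBounds L F G) (hL : 0 < L) (x y : E) :
    ‖G x - G y‖ ≤ L * ‖x - y‖ := by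
  have h1 := h.norm_sub_sq_le_inner hL x y
  have h2 := real_inner_le_norm (G x - G y) (x - y)
  rcases (norm_nonneg (G x - G y)).eq_or_lt with h0 | h0
  · rw [← h0]; positivity
  · have : ‖G x - G y‖ * ‖G x - G y‖ ≤ ‖G x - G y‖ * (L * ‖x - y‖) := by nlinarith
    exact le_of_mul_le_mul_left this h0

theorem continuous_slope (h : QuadBounds L F G) (hL : 0 < L) : Continuous G :=
  (LipschitzWith.of_dist_le_mul (K := L.toNNReal) fun x y => by
    rw [dist_eq_norm, dist_eq_norm, Real.coe_toNNReal _ hL.le]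
    exact h.norm_sub_le hL x y).continuous

/-- A gradient step of size 1 / L lowers `F` by ‖G x‖² / (2L) and cannot go below `c`; the infimum
need not be attained. -/
theorem norm_sq_le (h : QuadBounds L F G) (hL : 0 < L) {c : ℝ} (hc : ∀ w, c ≤ F w) (x : E) :
    ‖G x‖ ^ 2 ≤ 2 * L * (F x - c) := by
  have h2 := (h x (x - (1 / L) • G x)).2
  have h3 := hc (x - (1 / L) • G x)
  have e1 : x - (1 / L) • G x - x = -((1 / L) • G x) := by abel
  rw [e1, norm_neg, norm_smul, inner_neg_right, inner_smul_right, real_inner_self_eq_norm_sq,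
    Real.norm_of_nonneg (by positivity)] at h2
  have e2 : ‖G x‖ ^ 2 = 2 * L * (1 / L * ‖G x‖ ^ 2 - L / 2 * (1 / L * ‖G x‖) ^ 2) := by
    field_simp; ring
  rw [e2]
  exact mul_le_mul_of_nonneg_left (by linarith) (by positivity)

/-- A gradient step of length at most `2 / L` is nonexpansive. -/
theorem norm_step_sub_le (h : QuadBounds L F G) (hL : 0 < L) {η : ℝ} (h0 : 0 ≤ η)
    (hη : η * L ≤ 2) (x y : E) : ‖(x - η • G x) - (y - η • G y)‖ ≤ ‖x - y‖ := by
  refine le_of_sq_le_sq ?_ (norm_nonneg _)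
  have e : (x - η • G x) - (y - η • G y) = (x - y) - η • (G x - G y) := by
    rw [smul_sub]; abel
  rw [e, norm_sub_sq_real, inner_smul_right, norm_smul, Real.norm_of_nonneg h0, real_inner_comm]
  have h1 := h.norm_sub_sq_le_inner hL x y
  have h2 : 0 ≤ ⟪G x - G y, x - y⟫_ℝ := by
    by_contra! hn
    nlinarith [sq_nonneg ‖G x - G y‖, mul_pos_of_neg_of_neg hn (neg_neg_of_pos hL)]
  have h3 : η * ‖G x - G y‖ ^ 2 ≤ 2 * ⟪G x - G y, x - y⟫_ℝ := by
    calc η * ‖G x - G y‖ ^ 2 ≤ η * (L * ⟪G x - G y, x - y⟫_ℝ) := by gcongr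
      _ = η * L * ⟪G x - G y, x - y⟫_ℝ := by ring
      _ ≤ _ := by gcongr
  nlinarith [mul_le_mul_of_nonneg_left h3 h0]

/-- An affine function that is bounded below is constant. -/
theorem eq_of_lower_bound (h : QuadBounds 0 F G) {c : ℝ} (hc : ∀ w, c ≤ F w) (x y : E) :
    F x = F y := by
  have key : ∀ L : ℝ, 0 < L → QuadBounds L F G := fun L hL w v =>
    ⟨(h w v).1, (h w v).2.trans (by have := sq_nonneg ‖v - w‖; nlinarith)⟩
  have hG : ∀ x, G x = 0 := by
    intro x
    have hx : ‖G x‖ ^ 2 ≤ 0 := by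
      refine le_of_forall_pos_le_add fun ε hε => ?_
      have hp : 0 < 2 * (F x - c + 1) := by linarith [hc x]
      -- Every L > 0 is admissible; this one makes 2L(F x - c) at most ε, and the added 1 keeps the
      -- denominator positive.
      refine ((key (ε / (2 * (F x - c + 1))) (by positivity)).norm_sq_le (by positivity)
        hc x).trans ?_
      rw [zero_add, mul_div_assoc', div_mul_eq_mul_div, div_le_iff₀ hp]
      nlinarith
    simpa using hx.antisymm (sq_nonneg _)
  have h1 := (h x y).2
  have h2 := (h x y).1
  simp only [hG, inner_zero_left] at h1 h2
  linarith

/-- Averages of functions with quadratic bounds. -/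
theorem average {M : ℕ} {F : Fin M → E → ℝ} {G : Fin M → E → E} (hM : 0 < M)
    (h : ∀ m, QuadBounds L (F m) (G m)) :
    QuadBounds L (fun w => (1 / (M : ℝ)) * ∑ m, F m w)
      (fun w => (1 / (M : ℝ)) • ∑ m, G m w) := by
  intro w v
  have hM' : (0 : ℝ) < M := by exact_mod_cast hM
  have h1 := Finset.sum_le_sum fun m (_ : m ∈ Finset.univ) => (h m w v).1
  have h2 := Finset.sum_le_sum fun m (_ : m ∈ Finset.univ) => (h m w v).2
  simp only [Finset.sum_add_distrib, Finset.sum_const, Finset.card_univ, Fintype.card_fin,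
    nsmul_eq_mul] at h1 h2
  simp only [real_inner_smul_left, sum_inner]
  refine ⟨?_, ?_⟩
  · rw [← mul_add]
    exact mul_le_mul_of_nonneg_left h1 (by positivity)
  · have e : L / 2 * ‖v - w‖ ^ 2 = 1 / (M : ℝ) * (M * (L / 2 * ‖v - w‖ ^ 2)) := by field_simp
    rw [← mul_add, e, ← mul_add]
    exact mul_le_mul_of_nonneg_left h2 (by positivity)

end QuadBounds

end Deterministic

end LocalSGD

namespace LocalSGD
open scoped InnerProductSpace

/-! ### Independence: freezing lemmas and orthogonality of centred noise -/

section Expectation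

variable {Ω E : Type*} [MeasurableSpace Ω] {μ : Measure Ω} [NormedAddCommGroup E]

theorem integrable_inner_of_memLp [InnerProductSpace ℝ E] {X Y : Ω → E}
    (hX : MemLp X 2 μ) (hY : MemLp Y 2 μ) :
    Integrable (fun ω => ⟪X ω, Y ω⟫_ℝ) μ := by
  refine ((hX.integrable_norm_pow (by norm_num)).add
    (hY.integrable_norm_pow (by norm_num))).mono'
    (hX.aestronglyMeasurable.inner hY.aestronglyMeasurable)
    (Filter.Eventually.of_forall fun ω => ?_)
  have := norm_inner_le_norm (𝕜 := ℝ) (X ω) (Y ω)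
  simp only [Real.norm_eq_abs, Pi.add_apply] at this ⊢
  nlinarith [sq_nonneg (‖X ω‖ - ‖Y ω‖), sq_nonneg (‖X ω‖ + ‖Y ω‖)]

variable [IsProbabilityMeasure μ]

/-- Freezing lemma: a bound on the expectation over `Z` for every frozen value of `X` bounds the
expectation when `X` and `Z` are independent. -/
theorem integral_le_of_indepFun {𝒳 𝒵 : Type*} [MeasurableSpace 𝒳] [MeasurableSpace 𝒵]
    {X : Ω → 𝒳} {Z : Ω → 𝒵} (hX : Measurable X) (hZ : Measurable Z) (hXZ : IndepFun X Z μ)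
    {h : 𝒳 → 𝒵 → ℝ} (hm : Measurable (Function.uncurry h))
    (hi : Integrable (fun ω => h (X ω) (Z ω)) μ) {b : 𝒳 → ℝ} (hbm : Measurable b)
    (hb : Integrable (fun ω => b (X ω)) μ) (hle : ∀ x, ∫ z, h x z ∂(μ.map Z) ≤ b x) :
    ∫ ω, h (X ω) (Z ω) ∂μ ≤ ∫ ω, b (X ω) ∂μ := by
  have hmap := (indepFun_iff_map_prod_eq_prod_map_map hX.aemeasurable hZ.aemeasurable).1 hXZ
  have hXZm : Measurable fun ω => (X ω, Z ω) := hX.prodMk hZ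
  have : IsProbabilityMeasure (μ.map X) := Measure.isProbabilityMeasure_map hX.aemeasurable
  have : IsProbabilityMeasure (μ.map Z) := Measure.isProbabilityMeasure_map hZ.aemeasurable
  have hi' : Integrable (Function.uncurry h) ((μ.map X).prod (μ.map Z)) := by
    rw [← hmap]
    exact (integrable_map_measure hm.aestronglyMeasurable hXZm.aemeasurable).2 hi
  have hb' : Integrable b (μ.map X) :=
    (integrable_map_measure hbm.aestronglyMeasurable hX.aemeasurable).2 hb
  calc ∫ ω, h (X ω) (Z ω) ∂μ = ∫ p, Function.uncurry h p ∂(μ.map fun ω => (X ω, Z ω)) :=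
        (integral_map hXZm.aemeasurable hm.aestronglyMeasurable).symm
    _ = ∫ x, ∫ z, h x z ∂(μ.map Z) ∂(μ.map X) := by
        rw [hmap, integral_prod _ hi']; rfl
    _ ≤ ∫ x, b x ∂(μ.map X) := integral_mono hi'.integral_prod_left hb' hle
    _ = ∫ ω, b (X ω) ∂μ := integral_map hX.aemeasurable hbm.aestronglyMeasurable

/-- Freezing lemma for square integrability. -/
theorem memLp_two_of_indepFun {𝒳 𝒵 : Type*} [MeasurableSpace 𝒳] [MeasurableSpace 𝒵]
    {X : Ω → 𝒳} {Z : Ω → 𝒵} (hX : Measurable X) (hZ : Measurable Z) (hXZ : IndepFun X Z μ)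
    {h : 𝒳 → 𝒵 → E} (hm : StronglyMeasurable (Function.uncurry h)) {c : ℝ}
    (hi : ∀ x, Integrable (fun z => ‖h x z‖ ^ 2) (μ.map Z))
    (hle : ∀ x, ∫ z, ‖h x z‖ ^ 2 ∂(μ.map Z) ≤ c) :
    MemLp (fun ω => h (X ω) (Z ω)) 2 μ := by
  have hmap := (indepFun_iff_map_prod_eq_prod_map_map hX.aemeasurable hZ.aemeasurable).1 hXZ
  have hXZm : Measurable fun ω => (X ω, Z ω) := hX.prodMk hZ
  have : IsProbabilityMeasure (μ.map X) := Measure.isProbabilityMeasure_map hX.aemeasurable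
  have : IsProbabilityMeasure (μ.map Z) := Measure.isProbabilityMeasure_map hZ.aemeasurable
  have hsq : StronglyMeasurable fun p : 𝒳 × 𝒵 => ‖Function.uncurry h p‖ ^ 2 := hm.norm.pow 2
  have key : Integrable (fun p => ‖Function.uncurry h p‖ ^ 2) ((μ.map X).prod (μ.map Z)) := by
    rw [integrable_prod_iff hsq.aestronglyMeasurable]
    refine ⟨Filter.Eventually.of_forall hi, ?_⟩
    -- The inner second moments are bounded by `c` uniformly in the frozen value, so the outer
    -- integral is finite.
    refine Integrable.of_bound (C := c) hsq.norm.integral_prod_right.aestronglyMeasurable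
      (Filter.Eventually.of_forall fun x => ?_)
    rw [Real.norm_of_nonneg (integral_nonneg fun _ => norm_nonneg _)]
    simpa using hle x
  rw [← hmap] at key
  have := (integrable_map_measure hsq.aestronglyMeasurable hXZm.aemeasurable).1 key
  exact (memLp_two_iff_integrable_sq_norm (hm.comp_measurable hXZm).aestronglyMeasurable).2 this

variable [InnerProductSpace ℝ E] [CompleteSpace E]

/-- The cross term vanishes because the noise has mean zero. -/
theorem integral_norm_add_sq {N : Ω → E} (hN : MemLp N 2 μ) (h0 : ∫ ω, N ω ∂μ = 0) (a : E) :
    ∫ ω, ‖a + N ω‖ ^ 2 ∂μ = ‖a‖ ^ 2 + ∫ ω, ‖N ω‖ ^ 2 ∂μ := by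
  have hi : Integrable N μ := hN.integrable (by norm_num)
  have h1 : Integrable (fun ω => 2 * ⟪a, N ω⟫_ℝ) μ := (hi.const_inner a).const_mul 2
  have h2 : Integrable (fun ω => ‖N ω‖ ^ 2) μ := hN.integrable_norm_pow (by norm_num)
  simp_rw [norm_add_sq_real]
  have h3 : Integrable (fun ω => ‖a‖ ^ 2 + 2 * ⟪a, N ω⟫_ℝ) μ := (integrable_const _).add h1
  rw [integral_add h3 h2, integral_add (integrable_const _) h1,
    integral_const_mul, integral_inner hi, h0]
  simp

/-- Pairwise independence makes each off-diagonal inner product integrate to that of the means,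
which is zero. -/
theorem integral_norm_sum_sq {ι : Type*} [Fintype ι] [MeasurableSpace E] [BorelSpace E]
    {N : ι → Ω → E} (hN : ∀ i, MemLp (N i) 2 μ) (h0 : ∀ i, ∫ ω, N i ω ∂μ = 0)
    (hind : ∀ i j, i ≠ j → IndepFun (N i) (N j) μ) :
    ∫ ω, ‖∑ i, N i ω‖ ^ 2 ∂μ = ∑ i, ∫ ω, ‖N i ω‖ ^ 2 ∂μ := by
  simp_rw [← real_inner_self_eq_norm_sq, inner_sum, sum_inner]
  rw [integral_finsetSum _ fun i _ => integrable_finsetSum _ fun j _ =>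
    integrable_inner_of_memLp (hN j) (hN i)]
  refine Finset.sum_congr rfl fun i _ => ?_
  rw [integral_finsetSum _ fun j _ => integrable_inner_of_memLp (hN j) (hN i)]
  refine Finset.sum_eq_single i (fun j _ hji => ?_) (by simp)
  have := (hind j i hji).integral_bilin ((hN j).integrable (by norm_num))
    ((hN i).integrable (by norm_num)) (innerSL ℝ)
  simp only [h0, map_zero] at this
  exact this

end Expectation
end LocalSGD

namespace LocalSGD
open scoped InnerProductSpace

variable {d M : ℕ} {Ξ : Type*} [MeasurableSpace Ξ] {D : Fin M → Measure Ξ}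
  {f : Vec d → Ξ → ℝ} {H Fstar σ ζ η : ℝ}

/-! ### Measurability of stochastic gradients and regularity of the objectives -/

namespace CommonAssumption

theorem quadBounds (hA : CommonAssumption D f H Fstar) (z : Ξ) :
    QuadBounds (2 * H) (fun w => f w z) (fun w => stochGrad f w z) :=
  quadBounds_of_convexOn (hA.convex z) (hA.smooth z).1 (hA.smooth z).2

/-- Each coordinate is a pointwise limit of difference quotients with increment 1 / (n + 1), all
measurable in the sample. -/
theorem measurable_stochGrad (hA : CommonAssumption D f H Fstar) (w : Vec d) :
    Measurable (stochGrad f w) := by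
  have hcoord : ∀ i : Fin d, Measurable fun z => stochGrad f w z i := by
    intro i
    have hlim : ∀ z, Filter.Tendsto (fun n : ℕ => ((n : ℝ) + 1) *
        (f (w + ((n : ℝ) + 1)⁻¹ • EuclideanSpace.single i (1 : ℝ)) z - f w z)) Filter.atTop
        (nhds (stochGrad f w z i)) := by
      intro z
      have hd : HasFDerivAt (fun v => f v z)
          (InnerProductSpace.toDual ℝ (Vec d) (stochGrad f w z)) w :=
        hasGradientAt_iff_hasFDerivAt.1 ((hA.smooth z).1 w).hasGradientAt
      have h := hd.lim (EuclideanSpace.single i (1 : ℝ)) (l := Filter.atTop)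
        (c := fun n : ℕ => (n : ℝ) + 1) (by
          simp_rw [Real.norm_eq_abs]
          exact Filter.tendsto_abs_atTop_atTop.comp
            (Filter.tendsto_atTop_add_const_right _ _ tendsto_natCast_atTop_atTop))
      simpa [EuclideanSpace.inner_single_right] using h
    refine measurable_of_tendsto_metrizable (fun n => ?_) (tendsto_pi_nhds.2 hlim)
    exact ((hA.measurable _).sub (hA.measurable _)).const_mul _
  have h := (WithLp.measurable_toLp 2 (Fin d → ℝ)).comp (measurable_pi_iff.2 hcoord)
  exact h

theorem measurable_uncurry_stochGrad (hA : CommonAssumption D f H Fstar) (hH : 0 < H) :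
    Measurable (Function.uncurry (stochGrad f)) :=
  measurable_uncurry_of_continuous_of_measurable
    (fun z => (hA.quadBounds z).continuous_slope (by positivity)) hA.measurable_stochGrad

variable [∀ m, IsProbabilityMeasure (D m)]

/-- The bounds for single samples are integrated; unbiasedness turns the mean slope into the
gradient of F_m, so nothing is differentiated under the integral. -/
theorem localObj_quadBounds (hA : CommonAssumption D f H Fstar) (m : Fin M) :
    QuadBounds (2 * H) (localObj (D m) f) (gradient (localObj (D m) f)) := by
  intro w v
  have hg : Integrable (fun z => ⟪stochGrad f w z, v - w⟫_ℝ) (D m) :=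
    (hA.integrable_grad m w).inner_const _
  have e : ∫ z, ⟪stochGrad f w z, v - w⟫_ℝ ∂(D m) = ⟪gradient (localObj (D m) f) w, v - w⟫_ℝ := by
    simp_rw [real_inner_comm (v - w)]
    rw [integral_inner (hA.integrable_grad m w), hA.unbiased]
  have hlin : Integrable (fun z => f w z + ⟪stochGrad f w z, v - w⟫_ℝ) (D m) :=
    (hA.integrable m w).add hg
  have e1 : ∫ z, (f w z + ⟪stochGrad f w z, v - w⟫_ℝ) ∂(D m)
      = localObj (D m) f w + ⟪gradient (localObj (D m) f) w, v - w⟫_ℝ := by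
    rw [integral_add (hA.integrable m w) hg, e]; rfl
  rw [← e1]
  refine ⟨integral_mono hlin (hA.integrable m v) fun z => (hA.quadBounds z w v).1, ?_⟩
  have e2 : ∫ z, (f w z + ⟪stochGrad f w z, v - w⟫_ℝ + 2 * H / 2 * ‖v - w‖ ^ 2) ∂(D m)
      = ∫ z, (f w z + ⟪stochGrad f w z, v - w⟫_ℝ) ∂(D m) + 2 * H / 2 * ‖v - w‖ ^ 2 := by
    rw [integral_add hlin (integrable_const _)]; simp
  rw [← e2]
  exact integral_mono (hA.integrable m v) (hlin.add (integrable_const _))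
    fun z => (hA.quadBounds z w v).2

theorem gradient_globalObj (hA : CommonAssumption D f H Fstar) (hM : 0 < M) (w : Vec d) :
    gradient (globalObj D f) w = (1 / (M : ℝ)) • ∑ m, gradient (localObj (D m) f) w :=
  ((QuadBounds.average hM hA.localObj_quadBounds).hasGradientAt w).gradient

theorem globalObj_quadBounds (hA : CommonAssumption D f H Fstar) (hM : 0 < M) :
    QuadBounds (2 * H) (globalObj D f) (gradient (globalObj D f)) := by
  have h := QuadBounds.average hM hA.localObj_quadBounds
  rwa [← funext fun w => hA.gradient_globalObj hM w] at h

end CommonAssumption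

/-! ### Client averages and the deterministic one-step inequalities -/

/-- The mean of the clients' parameters. -/
noncomputable def clientMean (x : Fin M → Vec d) : Vec d := (1 / (M : ℝ)) • ∑ m, x m

/-- The mean squared distance of the clients' parameters to their mean. -/
noncomputable def consensusError (x : Fin M → Vec d) : ℝ := (1 / (M : ℝ)) * ∑ m, ‖x m - clientMean x‖ ^ 2

/-- One stochastic gradient step of all clients. -/
noncomputable def clientStep (f : Vec d → Ξ → ℝ) (η : ℝ) (x : Fin M → Vec d) (z : Fin M → Ξ) : Fin M → Vec d :=
  fun m => x m - η • stochGrad f (x m) (z m)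

/-- The deviation of a stochastic gradient of client `m` from its mean. -/
noncomputable def gradNoise (D : Fin M → Measure Ξ) (f : Vec d → Ξ → ℝ) (m : Fin M) (w : Vec d) (z : Ξ) :
    Vec d :=
  stochGrad f w z - gradient (localObj (D m) f) w

theorem norm_clientMean_sq_le (hM : 0 < M) (x : Fin M → Vec d) :
    ‖clientMean x‖ ^ 2 ≤ (1 / (M : ℝ)) * ∑ m, ‖x m‖ ^ 2 := by
  have hM' : (0 : ℝ) < M := by exact_mod_cast hM
  rw [clientMean, norm_smul, mul_pow, Real.norm_of_nonneg (by positivity)]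
  have h1 : ‖∑ m, x m‖ ^ 2 ≤ (M : ℝ) * ∑ m, ‖x m‖ ^ 2 := by
    calc ‖∑ m, x m‖ ^ 2 ≤ (∑ m, ‖x m‖) ^ 2 := by gcongr; exact norm_sum_le _ _
      _ ≤ _ := by simpa using sq_sum_le_card_mul_sum_sq (s := Finset.univ) (f := fun m => ‖x m‖)
  calc (1 / (M : ℝ)) ^ 2 * ‖∑ m, x m‖ ^ 2 ≤ (1 / (M : ℝ)) ^ 2 * ((M : ℝ) * ∑ m, ‖x m‖ ^ 2) := by
        gcongr
    _ = _ := by field_simp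

theorem clientMean_const (hM : 0 < M) (w : Vec d) : clientMean (fun _ : Fin M => w) = w := by
  have hM' : (M : ℝ) ≠ 0 := by exact_mod_cast hM.ne'
  simp [clientMean, ← Nat.cast_smul_eq_nsmul ℝ, smul_smul, hM']

theorem clientMean_sub (x y : Fin M → Vec d) :
    clientMean (fun m => x m - y m) = clientMean x - clientMean y := by
  simp [clientMean, smul_sub]

theorem clientMean_smul (c : ℝ) (x : Fin M → Vec d) :
    clientMean (fun m => c • x m) = c • clientMean x := by
  simp only [clientMean, ← Finset.smul_sum]
  rw [smul_comm]

theorem consensusError_nonneg (x : Fin M → Vec d) : 0 ≤ consensusError x := by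
  unfold consensusError; positivity

/-- The deviation from the mean is the mean of pairwise differences, so Jensen applies. This reduces
consensus to the pairwise drift bound. -/
theorem consensusError_le (hM : 0 < M) (x : Fin M → Vec d) :
    consensusError x ≤ (1 / (M : ℝ)) * ∑ m, (1 / (M : ℝ)) * ∑ n, ‖x m - x n‖ ^ 2 := by
  unfold consensusError
  gcongr with m _
  have h := norm_clientMean_sq_le hM fun n => x m - x n
  rwa [clientMean_sub (fun _ => x m), clientMean_const hM] at h

/-- Descent inequality for the averaged gradient of the clients. -/
theorem norm_clientMean_step_sq_le [∀ m, IsProbabilityMeasure (D m)]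
    (hA : CommonAssumption D f H Fstar) (hM : 0 < M) (hH : 0 < H) (hη : 0 ≤ η)
    (hηH : η * (8 * H) ≤ 1) (x : Fin M → Vec d) (u : Vec d) :
    ‖clientMean x - u - η • clientMean (fun m => gradient (localObj (D m) f) (x m))‖ ^ 2 ≤
      ‖clientMean x - u‖ ^ 2 - η * (globalObj D f (clientMean x) - Fstar)
        + 2 * η * (globalObj D f u - Fstar) + 3 * η * H * consensusError x := by
  have hM' : (0 : ℝ) < M := by exact_mod_cast hM
  set y := clientMean x with hy
  set g := clientMean (fun m => gradient (localObj (D m) f) (x m)) with hg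
  -- For each client, convexity at `x m` is used towards `u` and smoothness at `x m` towards `y`;
  -- with smoothness constant 2H the mismatch costs H‖x m - y‖².
  have hin : -⟪y - u, g⟫_ℝ ≤ globalObj D f u - globalObj D f y + H * consensusError x := by
    have h1 : ∀ m, -⟪y - u, gradient (localObj (D m) f) (x m)⟫_ℝ ≤
        localObj (D m) f u - localObj (D m) f y + H * ‖x m - y‖ ^ 2 := by
      intro m
      have ha := (hA.localObj_quadBounds m (x m) u).1
      have hb := (hA.localObj_quadBounds m (x m) y).2
      rw [norm_sub_rev y (x m)] at hb
      have e : ⟪y - u, gradient (localObj (D m) f) (x m)⟫_ℝ =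
          ⟪gradient (localObj (D m) f) (x m), y - x m⟫_ℝ
            - ⟪gradient (localObj (D m) f) (x m), u - x m⟫_ℝ := by
        rw [← inner_sub_right, real_inner_comm]; congr 1; abel
      rw [e]; linarith
    have h2 := Finset.sum_le_sum fun m (_ : m ∈ Finset.univ) => h1 m
    have h3 := mul_le_mul_of_nonneg_left h2 (show 0 ≤ 1 / (M : ℝ) by positivity)
    rw [Finset.sum_add_distrib, Finset.sum_sub_distrib, Finset.sum_neg_distrib,
      ← Finset.mul_sum, ← inner_sum] at h3
    rw [hg, clientMean, inner_smul_right]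
    unfold globalObj consensusError
    linarith
  -- Compare `g` with ∇F(y): the latter is controlled by suboptimality, the difference by the
  -- 2H-Lipschitz local gradients.
  have hnorm : ‖g‖ ^ 2 ≤
      8 * H * (globalObj D f y - Fstar) + 8 * H ^ 2 * consensusError x := by
    have hG := (hA.globalObj_quadBounds hM).norm_sq_le (by positivity) hA.lower_bound y
    have hdiff : g - gradient (globalObj D f) y =
        clientMean fun m => gradient (localObj (D m) f) (x m) - gradient (localObj (D m) f) y := by
      rw [clientMean_sub, hA.gradient_globalObj hM]; rfl
    have h1 : ‖g - gradient (globalObj D f) y‖ ^ 2 ≤ 4 * H ^ 2 * consensusError x := by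
      rw [hdiff]
      refine (norm_clientMean_sq_le hM _).trans ?_
      have : 4 * H ^ 2 * consensusError x =
          (1 / (M : ℝ)) * ∑ m, 4 * H ^ 2 * ‖x m - y‖ ^ 2 := by
        rw [consensusError, ← Finset.mul_sum]; ring
      rw [this]
      gcongr with m _
      have := (hA.localObj_quadBounds m).norm_sub_le (by positivity) (x m) y
      calc _ ≤ (2 * H * ‖x m - y‖) ^ 2 := by gcongr
        _ = _ := by ring
    have h2 : ‖g‖ ^ 2 ≤ 2 * ‖gradient (globalObj D f) y‖ ^ 2
        + 2 * ‖g - gradient (globalObj D f) y‖ ^ 2 := by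
      have h3 : ‖g‖ ≤ ‖gradient (globalObj D f) y‖ + ‖g - gradient (globalObj D f) y‖ := by
        simpa using norm_add_le (gradient (globalObj D f) y) (g - gradient (globalObj D f) y)
      nlinarith [norm_nonneg g, sq_nonneg
        (‖gradient (globalObj D f) y‖ - ‖g - gradient (globalObj D f) y‖)]
    linarith
  rw [norm_sub_sq_real, inner_smul_right, norm_smul, Real.norm_of_nonneg hη, mul_pow]
  have hV := consensusError_nonneg x
  have hF : 0 ≤ globalObj D f y - Fstar := by linarith [hA.lower_bound y]
  have h1 := mul_le_mul_of_nonneg_left hin hη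
  -- With 8ηH ≤ 1 the quadratic term consumes only half of the gain 2η(F(y) - F_*).
  have h2 : η ^ 2 * ‖g‖ ^ 2 ≤ η * (globalObj D f y - Fstar) + η * H * consensusError x := by
    calc η ^ 2 * ‖g‖ ^ 2 ≤ η ^ 2 *
          (8 * H * (globalObj D f y - Fstar) + 8 * H ^ 2 * consensusError x) := by gcongr
      _ = η * (η * (8 * H) * (globalObj D f y - Fstar + H * consensusError x)) := by ring
      _ ≤ η * (1 * (globalObj D f y - Fstar + H * consensusError x)) := by gcongr
      _ = _ := by ring
  linarith

/-- Exact gradient steps of two clients drift apart by at most `2 * η * ζ`. -/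
theorem norm_step_sub_step_le [∀ m, IsProbabilityMeasure (D m)]
    (hA : CommonAssumption D f H Fstar) (hζ : GlobalHeterogeneity D f ζ) (hM : 0 < M) (hH : 0 < H)
    (hη : 0 ≤ η) (hηH : η * (8 * H) ≤ 1) (m n : Fin M) (v w : Vec d) :
    ‖(v - η • gradient (localObj (D m) f) v) - (w - η • gradient (localObj (D n) f) w)‖ ≤
      ‖v - w‖ + 2 * η * ζ := by
  -- The comparison step is along ∇F for both clients; returning to each local gradient costs ηζ.
  have h1 := (hA.globalObj_quadBounds hM).norm_step_sub_le (by positivity) hη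
    (by nlinarith) v w
  have e : (v - η • gradient (localObj (D m) f) v) - (w - η • gradient (localObj (D n) f) w)
      = ((v - η • gradient (globalObj D f) v) - (w - η • gradient (globalObj D f) w))
        - η • ((gradient (localObj (D m) f) v - gradient (globalObj D f) v)
          - (gradient (localObj (D n) f) w - gradient (globalObj D f) w)) := by
    module
  rw [e]
  refine (norm_sub_le _ _).trans (add_le_add h1 ?_)
  rw [norm_smul, Real.norm_of_nonneg hη]
  have h2 := norm_sub_le (gradient (localObj (D m) f) v - gradient (globalObj D f) v)
    (gradient (localObj (D n) f) w - gradient (globalObj D f) w)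
  have h3 := hζ v m
  have h4 := hζ w n
  nlinarith

/-! ### One stochastic step in expectation, with frozen parameters -/

section OneStep

theorem memLp_gradNoise (hA : CommonAssumption D f H Fstar) (hσ : GlobalNoise D f σ) (m : Fin M)
    (w : Vec d) : MemLp (gradNoise D f m w) 2 (D m) :=
  (memLp_two_iff_integrable_sq_norm
    ((hA.measurable_stochGrad w).sub_const _).aestronglyMeasurable).2 (hσ w m).1

variable [∀ m, IsProbabilityMeasure (D m)]

theorem integral_gradNoise (hA : CommonAssumption D f H Fstar) (m : Fin M) (w : Vec d) :
    ∫ z, gradNoise D f m w z ∂(D m) = 0 := by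
  simp only [gradNoise]
  rw [integral_sub (hA.integrable_grad m w) (integrable_const _), hA.unbiased]
  simp

theorem memLp_gradNoise_eval (hA : CommonAssumption D f H Fstar) (hσ : GlobalNoise D f σ)
    (m : Fin M) (w : Vec d) :
    MemLp (fun z : Fin M → Ξ => gradNoise D f m w (z m)) 2 (Measure.pi D) :=
  (memLp_gradNoise hA hσ m w).comp_measurePreserving (measurePreserving_eval D m)

theorem integral_eval_pi {E : Type*} [NormedAddCommGroup E] [NormedSpace ℝ E] (m : Fin M)
    {g : Ξ → E} (hg : AEStronglyMeasurable g (D m)) :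
    ∫ z : Fin M → Ξ, g (z m) ∂(Measure.pi D) = ∫ z, g z ∂(D m) := by
  have h := measurePreserving_eval D m
  rw [← h.map_eq] at hg ⊢
  exact (integral_map h.measurable.aemeasurable hg).symm

theorem integral_gradNoise_eval (hA : CommonAssumption D f H Fstar) (hσ : GlobalNoise D f σ)
    (m : Fin M) (w : Vec d) :
    ∫ z : Fin M → Ξ, gradNoise D f m w (z m) ∂(Measure.pi D) = 0 := by
  rw [integral_eval_pi m (memLp_gradNoise hA hσ m w).aestronglyMeasurable,
    integral_gradNoise hA]

theorem integral_norm_gradNoise_eval_sq_le (hA : CommonAssumption D f H Fstar)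
    (hσ : GlobalNoise D f σ) (m : Fin M) (w : Vec d) :
    ∫ z : Fin M → Ξ, ‖gradNoise D f m w (z m)‖ ^ 2 ∂(Measure.pi D) ≤ σ ^ 2 := by
  rw [integral_eval_pi (g := fun z => ‖gradNoise D f m w z‖ ^ 2) m
    ((memLp_gradNoise hA hσ m w).aestronglyMeasurable.norm.pow 2)]
  exact (hσ w m).2

/-- The squared noises of the M independent clients add up to at most Mσ², and the averaging factor
is 1 / M². This is the source of the linear speed-up. -/
theorem integral_norm_clientMean_gradNoise_sq_le (hA : CommonAssumption D f H Fstar)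
    (hσ : GlobalNoise D f σ) (hM : 0 < M) (x : Fin M → Vec d) :
    ∫ z : Fin M → Ξ, ‖clientMean (fun m => gradNoise D f m (x m) (z m))‖ ^ 2 ∂(Measure.pi D) ≤
      σ ^ 2 / M := by
  have hM' : (0 : ℝ) < M := by exact_mod_cast hM
  have hind : iIndepFun (fun m (z : Fin M → Ξ) => gradNoise D f m (x m) (z m)) (Measure.pi D) :=
    iIndepFun_pi fun m => ((hA.measurable_stochGrad (x m)).sub_const _).aemeasurable
  have h := integral_norm_sum_sq (fun m => memLp_gradNoise_eval hA hσ m (x m))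
    (fun m => integral_gradNoise_eval hA hσ m (x m)) fun i j hij => hind.indepFun hij
  simp only [clientMean, norm_smul, mul_pow]
  rw [integral_const_mul, h, Real.norm_of_nonneg (by positivity)]
  calc _ ≤ (1 / (M : ℝ)) ^ 2 * ∑ _m : Fin M, σ ^ 2 := by
        gcongr with m _
        exact integral_norm_gradNoise_eval_sq_le hA hσ m (x m)
    _ = _ := by simp; field_simp

/-- Expected progress of the mean of the clients in one step. -/
theorem integral_norm_clientMean_clientStep_sq_le (hA : CommonAssumption D f H Fstar)
    (hσ : GlobalNoise D f σ) (hM : 0 < M) (hH : 0 < H) (hη : 0 ≤ η) (hηH : η * (8 * H) ≤ 1)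
    (x : Fin M → Vec d) (u : Vec d) :
    ∫ z, ‖clientMean (clientStep f η x z) - u‖ ^ 2 ∂(Measure.pi D) ≤
      ‖clientMean x - u‖ ^ 2 - η * (globalObj D f (clientMean x) - Fstar)
        + 2 * η * (globalObj D f u - Fstar) + 3 * η * H * consensusError x
        + η ^ 2 * (σ ^ 2 / M) := by
  have hL : MemLp (fun z : Fin M → Ξ => -η • clientMean (fun m => gradNoise D f m (x m) (z m))) 2
      (Measure.pi D) := by
    simp only [clientMean]
    exact ((memLp_finsetSum _ fun m _ => memLp_gradNoise_eval hA hσ m (x m)).const_smul (1 / (M : ℝ))).const_smul (-η)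
  have h0 : ∫ z : Fin M → Ξ, -η • clientMean (fun m => gradNoise D f m (x m) (z m))
      ∂(Measure.pi D) = 0 := by
    simp only [clientMean]
    rw [integral_smul, integral_smul, integral_finsetSum _ fun m _ =>
      (memLp_gradNoise_eval hA hσ m (x m)).integrable (by norm_num)]
    simp [integral_gradNoise_eval hA hσ]
  have e : ∀ z, clientMean (clientStep f η x z) - u =
      (clientMean x - u - η • clientMean (fun m => gradient (localObj (D m) f) (x m)))
        + -η • clientMean (fun m => gradNoise D f m (x m) (z m)) := by
    intro z
    have hs : clientStep f η x z = fun m => x m - η • stochGrad f (x m) (z m) := rfl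
    simp only [hs, gradNoise]
    rw [clientMean_sub, clientMean_sub, clientMean_smul]
    module
  simp_rw [e]
  rw [integral_norm_add_sq hL h0]
  simp only [norm_smul, mul_pow]
  rw [integral_const_mul]
  simp only [norm_neg, Real.norm_eq_abs, sq_abs]
  exact add_le_add (norm_clientMean_step_sq_le hA hM hH hη hηH x u)
    (mul_le_mul_of_nonneg_left (integral_norm_clientMean_gradNoise_sq_le hA hσ hM x)
      (sq_nonneg η))

/-- Expected growth of the distance between two clients in one step. -/
theorem integral_norm_clientStep_sub_sq_le (hA : CommonAssumption D f H Fstar)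
    (hσ : GlobalNoise D f σ) (hζ : GlobalHeterogeneity D f ζ) (hM : 0 < M) (hH : 0 < H)
    (hη : 0 ≤ η) (hηH : η * (8 * H) ≤ 1) {K : ℝ} (hK : 0 < K) (m n : Fin M)
    (x : Fin M → Vec d) :
    ∫ z, ‖clientStep f η x z m - clientStep f η x z n‖ ^ 2 ∂(Measure.pi D) ≤
      (1 + 1 / K) * ‖x m - x n‖ ^ 2 + (4 * (1 + K) * η ^ 2 * ζ ^ 2 + 4 * η ^ 2 * σ ^ 2) := by
  have hLm := memLp_gradNoise_eval hA hσ m (x m)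
  have hLn := memLp_gradNoise_eval hA hσ n (x n)
  have hL : MemLp (fun z : Fin M → Ξ =>
      -η • (gradNoise D f m (x m) (z m) - gradNoise D f n (x n) (z n))) 2 (Measure.pi D) :=
    (hLm.sub hLn).const_smul (-η)
  have h0 : ∫ z : Fin M → Ξ, -η • (gradNoise D f m (x m) (z m) - gradNoise D f n (x n) (z n))
      ∂(Measure.pi D) = 0 := by
    rw [integral_smul, integral_sub (hLm.integrable (by norm_num)) (hLn.integrable (by norm_num))]
    simp [integral_gradNoise_eval hA hσ]
  have e : ∀ z, clientStep f η x z m - clientStep f η x z n =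
      ((x m - η • gradient (localObj (D m) f) (x m))
        - (x n - η • gradient (localObj (D n) f) (x n)))
        + -η • (gradNoise D f m (x m) (z m) - gradNoise D f n (x n) (z n)) := by
    intro z
    simp only [clientStep, gradNoise]
    module
  simp_rw [e]
  rw [integral_norm_add_sq hL h0]
  simp only [norm_smul, mul_pow]
  rw [integral_const_mul]
  simp only [norm_neg, Real.norm_eq_abs, sq_abs]
  -- The crude bound ‖a - b‖² ≤ 2‖a‖² + 2‖b‖² needs no independence and so covers m = n as well.
  have hnoise : ∫ z : Fin M → Ξ, ‖gradNoise D f m (x m) (z m) - gradNoise D f n (x n) (z n)‖ ^ 2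
      ∂(Measure.pi D) ≤ 4 * σ ^ 2 := by
    have him := hLm.integrable_norm_pow (p := 2) (by norm_num)
    have hin := hLn.integrable_norm_pow (p := 2) (by norm_num)
    calc _ ≤ ∫ z : Fin M → Ξ, (2 * ‖gradNoise D f m (x m) (z m)‖ ^ 2
          + 2 * ‖gradNoise D f n (x n) (z n)‖ ^ 2) ∂(Measure.pi D) := by
          refine integral_mono ((hLm.sub hLn).integrable_norm_pow (p := 2) (by norm_num))
            ((him.const_mul 2).add (hin.const_mul 2)) fun z => ?_
          have := norm_sub_le (gradNoise D f m (x m) (z m)) (gradNoise D f n (x n) (z n))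
          simp only
          nlinarith [norm_nonneg (gradNoise D f m (x m) (z m) - gradNoise D f n (x n) (z n)),
            sq_nonneg (‖gradNoise D f m (x m) (z m)‖ - ‖gradNoise D f n (x n) (z n)‖)]
      _ = 2 * ∫ z : Fin M → Ξ, ‖gradNoise D f m (x m) (z m)‖ ^ 2 ∂(Measure.pi D)
          + 2 * ∫ z : Fin M → Ξ, ‖gradNoise D f n (x n) (z n)‖ ^ 2 ∂(Measure.pi D) := by
          rw [integral_add (him.const_mul 2) (hin.const_mul 2), integral_const_mul,
            integral_const_mul]
      _ ≤ _ := by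
          have h1 := integral_norm_gradNoise_eval_sq_le hA hσ m (x m)
          have h2 := integral_norm_gradNoise_eval_sq_le hA hσ n (x n)
          linarith
  have hdet : ‖(x m - η • gradient (localObj (D m) f) (x m))
        - (x n - η • gradient (localObj (D n) f) (x n))‖ ^ 2 ≤
      (1 + 1 / K) * ‖x m - x n‖ ^ 2 + 4 * (1 + K) * η ^ 2 * ζ ^ 2 := by
    have h1 := norm_step_sub_step_le hA hζ hM hH hη hηH m n (x m) (x n)
    -- Young's inequality weighted by `K`: the growth factor 1 + 1 / K stays bounded over K steps,
    -- at the price of a factor 1 + K on the ζ term.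
    have h2 : 0 ≤ 1 / K * (‖x m - x n‖ - K * (2 * η * ζ)) ^ 2 := by positivity
    have h3 : 1 / K * (‖x m - x n‖ - K * (2 * η * ζ)) ^ 2 = 1 / K * ‖x m - x n‖ ^ 2
        - 2 * ‖x m - x n‖ * (2 * η * ζ) + K * (2 * η * ζ) ^ 2 := by
      field_simp; ring
    calc _ ≤ (‖x m - x n‖ + 2 * η * ζ) ^ 2 := by gcongr
      _ ≤ _ := by linarith
  nlinarith [mul_le_mul_of_nonneg_left hnoise (sq_nonneg η)]

end OneStep

end LocalSGD

namespace LocalSGD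
open scoped InnerProductSpace

/-- Unrolling gives at most k·c·(1 + 1/K)^k, and (1 + 1/K)^K ≤ e ≤ 3. -/
theorem le_of_linear_recurrence {K : ℕ} (hK : 0 < K) {a : ℕ → ℝ} {c : ℝ} (hc : 0 ≤ c)
    (h0 : a 0 = 0) (h : ∀ k < K, a (k + 1) ≤ (1 + 1 / (K : ℝ)) * a k + c) :
    ∀ k ≤ K, a k ≤ 3 * K * c := by
  have hK' : (0 : ℝ) < K := by exact_mod_cast hK
  have hq : 1 ≤ 1 + 1 / (K : ℝ) := by simp
  have key : ∀ k ≤ K, a k ≤ k * c * (1 + 1 / (K : ℝ)) ^ k := by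
    intro k
    induction k with
    | zero => simp [h0]
    | succ k ih =>
      intro hk
      have h1 := h k (by omega)
      have h2 := ih (by omega)
      have h3 : c ≤ c * (1 + 1 / (K : ℝ)) ^ (k + 1) :=
        le_mul_of_one_le_right hc (one_le_pow₀ hq)
      calc a (k + 1) ≤ (1 + 1 / (K : ℝ)) * (k * c * (1 + 1 / (K : ℝ)) ^ k)
            + c * (1 + 1 / (K : ℝ)) ^ (k + 1) := by
            refine h1.trans (add_le_add (mul_le_mul_of_nonneg_left h2 (by positivity)) h3)
        _ = _ := by push_cast; ring
  have hexp : (1 + 1 / (K : ℝ)) ^ K ≤ 3 := by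
    calc (1 + 1 / (K : ℝ)) ^ K ≤ (Real.exp (1 / K)) ^ K := by
          gcongr
          linarith [Real.add_one_le_exp (1 / (K : ℝ))]
      _ = Real.exp 1 := by
          rw [← Real.exp_nat_mul]; congr 1; field_simp
      _ ≤ 3 := Real.exp_one_lt_three.le
  intro k hk
  calc a k ≤ k * c * (1 + 1 / (K : ℝ)) ^ k := key k hk
    _ ≤ K * c * 3 := by
        gcongr
        exact (pow_le_pow_right₀ hq hk).trans hexp
    _ = _ := by ring

/-! ### Integrability and measurability of the iterates -/

section Integrability

variable {Ω E : Type*} [MeasurableSpace Ω] {μ : Measure Ω} [IsProbabilityMeasure μ]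
  [NormedAddCommGroup E] [InnerProductSpace ℝ E] {L : ℝ} {F : E → ℝ} {G : E → E}

/-- The bounds at 0 sandwich F(Y) between an affine and a quadratic function of Y. -/
theorem QuadBounds.integrable_comp [CompleteSpace E] (h : QuadBounds L F G) {Y : Ω → E} (hY : MemLp Y 2 μ) :
    Integrable (fun ω => F (Y ω)) μ := by
  have h1 : Integrable Y μ := hY.integrable (by norm_num)
  have h2 : Integrable (fun ω => ‖Y ω‖ ^ 2) μ := hY.integrable_norm_pow (by norm_num)
  have hl : Integrable (fun ω => F 0 + ⟪G 0, Y ω⟫_ℝ) μ :=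
    (integrable_const _).add (h1.const_inner _)
  refine integrable_of_le_of_le (h.continuous.comp_aestronglyMeasurable hY.aestronglyMeasurable)
    (Filter.Eventually.of_forall fun ω => ?_) (Filter.Eventually.of_forall fun ω => ?_) hl
    (hl.add (h2.const_mul (L / 2)))
  · simpa using (h 0 (Y ω)).1
  · simpa using (h 0 (Y ω)).2

theorem QuadBounds.memLp_slope_comp (h : QuadBounds L F G) (hL : 0 < L) {Y : Ω → E}
    (hY : MemLp Y 2 μ) : MemLp (fun ω => G (Y ω)) 2 μ := by
  refine ((memLp_const ‖G 0‖).add (hY.norm.const_mul L)).mono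
    ((h.continuous_slope hL).comp_aestronglyMeasurable hY.aestronglyMeasurable)
    (Filter.Eventually.of_forall fun ω => ?_)
  have h1 := h.norm_sub_le hL (Y ω) 0
  have h2 : ‖G (Y ω)‖ ≤ ‖G 0‖ + ‖G (Y ω) - G 0‖ := by
    simpa using norm_add_le (G 0) (G (Y ω) - G 0)
  rw [sub_zero] at h1
  simp only [Pi.add_apply, Real.norm_eq_abs]
  exact (h2.trans (by linarith)).trans (le_abs_self _)

end Integrability

variable {d M K R : ℕ} {Ξ : Type*} {f : Vec d → Ξ → ℝ} {H Fstar σ ζ η : ℝ}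

/-- The parameters of all clients after `k` local steps of round `r`. -/
noncomputable def clients (f : Vec d → Ξ → ℝ) (η : ℝ) (K : ℕ) (s : ℕ → ℕ → Fin M → Ξ)
    (w₀ : Vec d) (r k : ℕ) : Fin M → Vec d :=
  fun m => localIterate f η (fun j => s r j m) (roundIterate f η K s w₀ r) k

theorem clients_zero_zero (s : ℕ → ℕ → Fin M → Ξ) (w₀ : Vec d) :
    clients f η K s w₀ 0 0 = fun _ => w₀ := rfl

theorem clients_zero (s : ℕ → ℕ → Fin M → Ξ) (w₀ : Vec d) (r : ℕ) :
    clients f η K s w₀ (r + 1) 0 = fun _ => clientMean (clients f η K s w₀ r K) := rfl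

theorem clients_succ (s : ℕ → ℕ → Fin M → Ξ) (w₀ : Vec d) (r k : ℕ) :
    clients f η K s w₀ r (k + 1) = clientStep f η (clients f η K s w₀ r k) (s r k) := rfl

theorem localSGD_eq (s : ℕ → ℕ → Fin M → Ξ) (w₀ : Vec d) (α : ℕ → ℕ → ℝ) :
    localSGD f η K R α s w₀ = ∑ i ∈ Finset.range R ×ˢ Finset.range K,
      α i.1 i.2 • clientMean (clients f η K s w₀ i.1 i.2) := by
  rw [Finset.sum_product]; rfl

variable [MeasurableSpace Ξ] {D : Fin M → Measure Ξ}

theorem measurable_clientMean : Measurable (clientMean : (Fin M → Vec d) → Vec d) := by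
  unfold clientMean; fun_prop

theorem measurable_consensusError : Measurable (consensusError : (Fin M → Vec d) → ℝ) := by
  unfold consensusError
  have := measurable_clientMean (M := M) (d := d)
  fun_prop

theorem measurable_clientStep (hA : CommonAssumption D f H Fstar) (hH : 0 < H) :
    Measurable (Function.uncurry (clientStep (M := M) f η)) := by
  refine measurable_pi_iff.2 fun m => ?_
  have h1 : Measurable fun p : (Fin M → Vec d) × (Fin M → Ξ) => p.1 m := by fun_prop
  have h2 : Measurable fun p : (Fin M → Vec d) × (Fin M → Ξ) => p.2 m := by fun_prop
  exact h1.sub (((hA.measurable_uncurry_stochGrad hH).comp (h1.prodMk h2)).const_smul η)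

/-- The iterates are measurable for every σ-algebra for which the earlier samples are. -/
theorem measurable_clients {Ω : Type*} [MeasurableSpace Ω] (hA : CommonAssumption D f H Fstar)
    (hH : 0 < H) (w₀ : Vec d) {ξ : ℕ → ℕ → Fin M → Ω → Ξ} (r : ℕ) :
    ∀ k, (∀ r' k' m, (r' < r ∧ k' < K) ∨ (r' = r ∧ k' < k) → Measurable (ξ r' k' m)) →
      Measurable fun ω => clients f η K (fun r k m => ξ r k m ω) w₀ r k := by
  have hstep : ∀ r, (Measurable fun ω => clients f η K (fun r k m => ξ r k m ω) w₀ r 0) →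
      ∀ k, (∀ k' < k, ∀ m, Measurable (ξ r k' m)) →
        Measurable fun ω => clients f η K (fun r k m => ξ r k m ω) w₀ r k := by
    intro r h0 k
    induction k with
    | zero => exact fun _ => h0
    | succ k ih =>
      intro hk
      simp only [clients_succ]
      exact (measurable_clientStep hA hH).comp ((ih fun k' hk' => hk k' (by omega)).prodMk
        (measurable_pi_iff.2 fun m => hk k (by omega) m))
  induction r with
  | zero =>
    intro k hk
    refine hstep 0 ?_ k fun k' hk' m => hk 0 k' m (Or.inr ⟨rfl, hk'⟩)
    simp only [clients_zero_zero]
    exact measurable_const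
  | succ r ih =>
    intro k hk
    refine hstep (r + 1) ?_ k fun k' hk' m => hk (r + 1) k' m (Or.inr ⟨rfl, hk'⟩)
    simp only [clients_zero]
    refine measurable_pi_iff.2 fun _ => measurable_clientMean.comp (ih K fun r' k' m h => ?_)
    exact hk r' k' m (Or.inl (by omega))

/-! ### Independence along a run and the accumulated error bounds -/

section Run

variable {Ω : Type*} [MeasurableSpace Ω] {P : Measure Ω}
  {ξ : ℕ → ℕ → Fin M → Ω → Ξ}

/-- The current samples are independent of the current iterates. -/
theorem indepFun_clients (hA : CommonAssumption D f H Fstar) (hH : 0 < H) (w₀ : Vec d)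
    (hmeas : ∀ r < R, ∀ k < K, ∀ m, Measurable (ξ r k m)) (hξ : IsSampling K R D P ξ)
    {r k : ℕ} (hr : r < R) (hk : k < K) :
    IndepFun (fun ω => clients f η K (fun r k m => ξ r k m ω) w₀ r k) (fun ω m => ξ r k m ω) P := by
  let 𝓜 : Fin R × Fin K × Fin M → MeasurableSpace Ω := fun i =>
    MeasurableSpace.comap (ξ i.1 i.2.1 i.2.2) inferInstance
  -- `S` indexes the samples drawn strictly before step (r, k), `T` those drawn in it; disjoint
  -- index sets generate independent σ-algebras.
  let S : Set (Fin R × Fin K × Fin M) := {i | i.1.1 < r ∨ i.1.1 = r ∧ i.2.1.1 < k}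
  let T : Set (Fin R × Fin K × Fin M) := {i | i.1.1 = r ∧ i.2.1.1 = k}
  have hST : Disjoint S T := by
    rw [Set.disjoint_left]
    rintro i (h | ⟨_, h⟩) ⟨h1, h2⟩ <;> omega
  have hle : ∀ i, 𝓜 i ≤ ‹MeasurableSpace Ω› := fun i =>
    (hmeas _ i.1.2 _ i.2.1.2 i.2.2).comap_le
  have hind := indep_iSup_of_disjoint (m := 𝓜) hle hξ.2 hST
  have hX : Measurable[⨆ i ∈ S, 𝓜 i]
      fun ω => clients f η K (fun r k m => ξ r k m ω) w₀ r k := by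
    -- The ambient σ-algebra on Ω is replaced here by the one generated by the past samples.
    refine @measurable_clients d M K Ξ f H Fstar η _ D Ω (⨆ i ∈ S, 𝓜 i) hA hH w₀ ξ r k ?_
    intro r' k' m h
    have h1 : r' < R := by omega
    have h2 : k' < K := by omega
    have hi : ((⟨r', h1⟩, ⟨k', h2⟩, m) : Fin R × Fin K × Fin M) ∈ S := by
      simp only [S, Set.mem_ofPred_eq]; omega
    exact measurable_iff_comap_le.2
      (le_iSup₂ (f := fun i (_ : i ∈ S) => 𝓜 i) (⟨r', h1⟩, ⟨k', h2⟩, m) hi)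
  have hZ : Measurable[⨆ i ∈ T, 𝓜 i] fun ω m => ξ r k m ω := by
    refine @measurable_pi_lambda Ω _ _ (⨆ i ∈ T, 𝓜 i) _ _ fun m => ?_
    have hi : ((⟨r, hr⟩, ⟨k, hk⟩, m) : Fin R × Fin K × Fin M) ∈ T := ⟨rfl, rfl⟩
    exact measurable_iff_comap_le.2
      (le_iSup₂ (f := fun i (_ : i ∈ T) => 𝓜 i) (⟨r, hr⟩, ⟨k, hk⟩, m) hi)
  exact indep_of_indep_of_le_left (indep_of_indep_of_le_right hind hZ.comap_le) hX.comap_le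

/-- Joint independence restricts to the samples of one step, whose law is therefore the product
measure used in the one-step estimates. -/
theorem map_samples [IsProbabilityMeasure P] (hξ : IsSampling K R D P ξ) {r k : ℕ} (hr : r < R) (hk : k < K) :
    P.map (fun ω m => ξ r k m ω) = Measure.pi D := by
  have hinj : Function.Injective
      fun m : Fin M => ((⟨r, hr⟩, ⟨k, hk⟩, m) : Fin R × Fin K × Fin M) := by
    intro m n h; simpa using h
  have h := (iIndepFun_iff_map_fun_eq_pi_map fun m => (hξ.1 r hr k hk m).aemeasurable).1
    (hξ.2.precomp
    (g := fun m : Fin M => ((⟨r, hr⟩, ⟨k, hk⟩, m) : Fin R × Fin K × Fin M)) hinj)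
  rw [h]
  congr 1
  exact funext fun m => (hξ.1 r hr k hk m).map_eq

/-- The standing assumptions on one run of the algorithm, with measurable samples. -/
structure IsRun (D : Fin M → Measure Ξ) (f : Vec d → Ξ → ℝ) (H Fstar σ ζ η : ℝ) (K R : ℕ)
    (P : Measure Ω) (ξ : ℕ → ℕ → Fin M → Ω → Ξ) : Prop where
  common : CommonAssumption D f H Fstar
  noise : GlobalNoise D f σ
  heterogeneity : GlobalHeterogeneity D f ζ
  measurable : ∀ r < R, ∀ k < K, ∀ m, Measurable (ξ r k m)
  sampling : IsSampling K R D P ξ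
  clients_pos : 0 < M
  steps_pos : 0 < K
  rounds_pos : 0 < R
  smooth_pos : 0 < H
  step_pos : 0 < η
  step_le : η * (8 * H) ≤ 1

namespace IsRun

theorem measurable_clients (h : IsRun D f H Fstar σ ζ η K R P ξ) (w₀ : Vec d) {r k : ℕ}
    (hr : r < R) (hk : k ≤ K) :
    Measurable fun ω => clients f η K (fun r k m => ξ r k m ω) w₀ r k :=
  LocalSGD.measurable_clients h.common h.smooth_pos w₀ r k fun r' k' m hrk =>
    h.measurable r' (by omega) k' (by omega) m

theorem measurable_samples (h : IsRun D f H Fstar σ ζ η K R P ξ) {r k : ℕ}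
    (hr : r < R) (hk : k < K) : Measurable fun ω m => ξ r k m ω :=
  measurable_pi_iff.2 fun m => h.measurable r hr k hk m

theorem indepFun_clients (h : IsRun D f H Fstar σ ζ η K R P ξ) (w₀ : Vec d) {r k : ℕ}
    (hr : r < R) (hk : k < K) :
    IndepFun (fun ω => clients f η K (fun r k m => ξ r k m ω) w₀ r k) (fun ω m => ξ r k m ω) P :=
  LocalSGD.indepFun_clients h.common h.smooth_pos w₀ h.measurable h.sampling hr hk

theorem memLp_clientMean {X : Ω → Fin M → Vec d} (hX : ∀ m, MemLp (fun ω => X ω m) 2 P) :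
    MemLp (fun ω => clientMean (X ω)) 2 P := by
  simp only [clientMean]
  exact (memLp_finsetSum _ fun m _ => hX m).const_smul (1 / (M : ℝ))

theorem integrable_norm_sq {Y : Ω → Vec d} (hY : MemLp Y 2 P) :
    Integrable (fun ω => ‖Y ω‖ ^ 2) P := hY.integrable_norm_pow (by norm_num)

variable [IsProbabilityMeasure P] [∀ m, IsProbabilityMeasure (D m)]

theorem memLp_step (h : IsRun D f H Fstar σ ζ η K R P ξ) (w₀ : Vec d) {r k : ℕ}
    (hr : r < R) (hk : k < K)
    (hX : ∀ m, MemLp (fun ω => clients f η K (fun r k m => ξ r k m ω) w₀ r k m) 2 P) (m : Fin M) :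
    MemLp (fun ω => clients f η K (fun r k m => ξ r k m ω) w₀ r (k + 1) m) 2 P := by
  have hA := h.common
  have hLpos : 0 < 2 * H := by have := h.smooth_pos; positivity
  have hG := (hA.localObj_quadBounds m).memLp_slope_comp hLpos (hX m)
  have hmeas : Measurable (Function.uncurry fun (x : Fin M → Vec d) (z : Fin M → Ξ) =>
      gradNoise D f m (x m) (z m)) := by
    have h1 : Measurable fun p : (Fin M → Vec d) × (Fin M → Ξ) => p.1 m := by fun_prop
    have h2 : Measurable fun p : (Fin M → Vec d) × (Fin M → Ξ) => p.2 m := by fun_prop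
    exact ((hA.measurable_uncurry_stochGrad h.smooth_pos).comp (h1.prodMk h2)).sub
      (((hA.localObj_quadBounds m).continuous_slope hLpos).measurable.comp h1)
  -- The noise has second moment at most σ² for every frozen parameter; the exact gradient is
  -- handled by its Lipschitz bound in `hG`.
  have hN := memLp_two_of_indepFun (h.measurable_clients w₀ hr hk.le)
    (h.measurable_samples hr hk) (h.indepFun_clients w₀ hr hk) hmeas.stronglyMeasurable
    (c := σ ^ 2)
    (fun x => by
      rw [map_samples h.sampling hr hk]
      exact (memLp_gradNoise_eval hA h.noise m (x m)).integrable_norm_pow (by norm_num))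
    (fun x => by
      rw [map_samples h.sampling hr hk]
      exact integral_norm_gradNoise_eval_sq_le hA h.noise m (x m))
  refine ((hX m).sub ((hG.add hN).const_smul η)).ae_eq (Filter.Eventually.of_forall fun ω => ?_)
  simp only [Pi.sub_apply, Pi.add_apply, Pi.smul_apply, clients_succ, clientStep, gradNoise]
  module

theorem memLp_clients (h : IsRun D f H Fstar σ ζ η K R P ξ) (w₀ : Vec d) {r : ℕ} (hr : r < R) :
    ∀ k ≤ K, ∀ m, MemLp (fun ω => clients f η K (fun r k m => ξ r k m ω) w₀ r k m) 2 P := by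
  have hround : ∀ r < R,
      (∀ m, MemLp (fun ω => clients f η K (fun r k m => ξ r k m ω) w₀ r 0 m) 2 P) →
      ∀ k ≤ K, ∀ m, MemLp (fun ω => clients f η K (fun r k m => ξ r k m ω) w₀ r k m) 2 P := by
    intro r hr h0 k
    induction k with
    | zero => exact fun _ => h0
    | succ k ih => exact fun hk => h.memLp_step w₀ hr (by omega) (ih (by omega))
  induction r with
  | zero =>
    refine hround 0 hr fun m => ?_
    simp only [clients_zero_zero]
    exact memLp_const _
  | succ r ih =>
    refine hround (r + 1) hr fun m => ?_
    simp only [clients_zero]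
    exact memLp_clientMean (ih (by omega) K le_rfl)

/-- Two clients drift apart by `O(η ^ 2 * (K ^ 2 * ζ ^ 2 + K * σ ^ 2))` within a round. -/
theorem integral_norm_clients_sub_sq_le (h : IsRun D f H Fstar σ ζ η K R P ξ) (w₀ : Vec d) {r k : ℕ}
    (hr : r < R) (hk : k ≤ K) (m n : Fin M) :
    ∫ ω, ‖clients f η K (fun r k m => ξ r k m ω) w₀ r k m
        - clients f η K (fun r k m => ξ r k m ω) w₀ r k n‖ ^ 2 ∂P ≤
      24 * K ^ 2 * η ^ 2 * ζ ^ 2 + 12 * K * η ^ 2 * σ ^ 2 := by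
  have hK : (0 : ℝ) < K := by exact_mod_cast h.steps_pos
  have hK1 : (1 : ℝ) ≤ K := by exact_mod_cast h.steps_pos
  have hL : ∀ k ≤ K, MemLp (fun ω => clients f η K (fun r k m => ξ r k m ω) w₀ r k m
        - clients f η K (fun r k m => ξ r k m ω) w₀ r k n) 2 P := fun k hk =>
    (h.memLp_clients w₀ hr k hk m).sub (h.memLp_clients w₀ hr k hk n)
  have key := le_of_linear_recurrence h.steps_pos
    (a := fun k => ∫ ω, ‖clients f η K (fun r k m => ξ r k m ω) w₀ r k m
        - clients f η K (fun r k m => ξ r k m ω) w₀ r k n‖ ^ 2 ∂P)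
    (c := 4 * (1 + K) * η ^ 2 * ζ ^ 2 + 4 * η ^ 2 * σ ^ 2) (by positivity) ?_ ?_ k hk
  · refine key.trans ?_
    -- The recurrence yields 12K(1 + K) in front of η²ζ², and 1 + K ≤ 2K.
    have : 0 ≤ η ^ 2 * ζ ^ 2 * K := by positivity
    nlinarith
  -- All clients coincide at the start of a round.
  · cases r <;> simp [clients_zero, clients_zero_zero]
  · intro k hk
    have hm : Measurable fun x : Fin M → Vec d =>
        (1 + 1 / (K : ℝ)) * ‖x m - x n‖ ^ 2
          + (4 * (1 + K) * η ^ 2 * ζ ^ 2 + 4 * η ^ 2 * σ ^ 2) := by fun_prop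
    have hi : Integrable (fun ω => (1 + 1 / (K : ℝ)) *
        ‖clients f η K (fun r k m => ξ r k m ω) w₀ r k m
          - clients f η K (fun r k m => ξ r k m ω) w₀ r k n‖ ^ 2) P :=
      (integrable_norm_sq (hL k hk.le)).const_mul _
    have hstep : Measurable (Function.uncurry fun (x : Fin M → Vec d) (z : Fin M → Ξ) =>
        ‖clientStep f η x z m - clientStep f η x z n‖ ^ 2) := by
      have := measurable_clientStep (η := η) h.common h.smooth_pos
      exact (((measurable_pi_apply m).comp this).sub
        ((measurable_pi_apply n).comp this)).norm.pow_const 2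
    have := integral_le_of_indepFun (h.measurable_clients w₀ hr hk.le)
      (h.measurable_samples hr hk) (h.indepFun_clients w₀ hr hk) hstep
      (integrable_norm_sq (hL (k + 1) hk)) hm (hi.add (integrable_const _)) (fun x => by
        rw [map_samples h.sampling hr hk]
        exact integral_norm_clientStep_sub_sq_le h.common h.noise h.heterogeneity h.clients_pos
          h.smooth_pos h.step_pos.le h.step_le hK m n x)
    rw [integral_add hi (integrable_const _), integral_const_mul, integral_const, probReal_univ,
      one_smul] at this
    exact this

theorem integrable_consensusError (h : IsRun D f H Fstar σ ζ η K R P ξ) (w₀ : Vec d) {r k : ℕ}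
    (hr : r < R) (hk : k ≤ K) :
    Integrable (fun ω => consensusError (clients f η K (fun r k m => ξ r k m ω) w₀ r k)) P := by
  have hL := h.memLp_clients w₀ hr k hk
  exact (integrable_finsetSum _ fun m _ =>
    integrable_norm_sq ((hL m).sub (memLp_clientMean hL))).const_mul _

theorem integral_consensusError_le (h : IsRun D f H Fstar σ ζ η K R P ξ) (w₀ : Vec d) {r k : ℕ}
    (hr : r < R) (hk : k ≤ K) :
    ∫ ω, consensusError (clients f η K (fun r k m => ξ r k m ω) w₀ r k) ∂P ≤
      24 * K ^ 2 * η ^ 2 * ζ ^ 2 + 12 * K * η ^ 2 * σ ^ 2 := by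
  have hM : (0 : ℝ) < M := by exact_mod_cast h.clients_pos
  have hL := h.memLp_clients w₀ hr k hk
  have hi : ∀ m n, Integrable (fun ω => ‖clients f η K (fun r k m => ξ r k m ω) w₀ r k m
      - clients f η K (fun r k m => ξ r k m ω) w₀ r k n‖ ^ 2) P :=
    fun m n => integrable_norm_sq ((hL m).sub (hL n))
  have hi' : ∀ m, Integrable (fun ω => (1 / (M : ℝ)) * ∑ n,
      ‖clients f η K (fun r k m => ξ r k m ω) w₀ r k m
      - clients f η K (fun r k m => ξ r k m ω) w₀ r k n‖ ^ 2) P :=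
    fun m => (integrable_finsetSum _ fun n _ => hi m n).const_mul _
  refine (integral_mono (h.integrable_consensusError w₀ hr hk)
    ((integrable_finsetSum _ fun m _ => hi' m).const_mul _)
    fun ω => consensusError_le h.clients_pos _).trans ?_
  rw [integral_const_mul, integral_finsetSum _ fun m _ => hi' m]
  calc _ ≤ (1 / (M : ℝ)) * ∑ _m : Fin M, (1 / (M : ℝ)) * ∑ _n : Fin M,
        (24 * K ^ 2 * η ^ 2 * ζ ^ 2 + 12 * K * η ^ 2 * σ ^ 2) := by
        gcongr with m _
        rw [integral_const_mul, integral_finsetSum _ fun n _ => hi m n]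
        gcongr with n _
        exact h.integral_norm_clients_sub_sq_le w₀ hr hk m n
    _ = _ := by
        simp only [Finset.sum_const, Finset.card_univ, Fintype.card_fin, nsmul_eq_mul]
        field_simp

/-- Expected progress of the mean of the clients. -/
theorem integral_norm_mean_succ_le (h : IsRun D f H Fstar σ ζ η K R P ξ) (w₀ u : Vec d) {r k : ℕ}
    (hr : r < R) (hk : k < K) :
    ∫ ω, ‖clientMean (clients f η K (fun r k m => ξ r k m ω) w₀ r (k + 1)) - u‖ ^ 2 ∂P ≤
      ∫ ω, ‖clientMean (clients f η K (fun r k m => ξ r k m ω) w₀ r k) - u‖ ^ 2 ∂P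
      - η * ∫ ω, (globalObj D f (clientMean (clients f η K (fun r k m => ξ r k m ω) w₀ r k))
          - Fstar) ∂P
      + (2 * η * (globalObj D f u - Fstar)
        + 3 * η * H * (24 * K ^ 2 * η ^ 2 * ζ ^ 2 + 12 * K * η ^ 2 * σ ^ 2)
        + η ^ 2 * (σ ^ 2 / M)) := by
  have hF := h.common.globalObj_quadBounds h.clients_pos
  have hL : ∀ k ≤ K, MemLp
      (fun ω => clientMean (clients f η K (fun r k m => ξ r k m ω) w₀ r k)) 2 P :=
    fun k hk => memLp_clientMean (h.memLp_clients w₀ hr k hk)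
  have hi : ∀ k ≤ K, Integrable
      (fun ω => ‖clientMean (clients f η K (fun r k m => ξ r k m ω) w₀ r k) - u‖ ^ 2) P :=
    fun k hk => integrable_norm_sq ((hL k hk).sub (memLp_const u))
  have hiF : Integrable (fun ω => η * (globalObj D f
      (clientMean (clients f η K (fun r k m => ξ r k m ω) w₀ r k)) - Fstar)) P :=
    ((hF.integrable_comp (hL k hk.le)).sub (integrable_const _)).const_mul _
  have hiV := (h.integrable_consensusError w₀ hr hk.le).const_mul (3 * η * H)
  have hstep : Measurable (Function.uncurry fun (x : Fin M → Vec d) (z : Fin M → Ξ) =>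
      ‖clientMean (clientStep f η x z) - u‖ ^ 2) :=
    ((measurable_clientMean.comp
      (measurable_clientStep (η := η) h.common h.smooth_pos)).sub_const u).norm.pow_const 2
  have hb : Measurable fun x : Fin M → Vec d => ‖clientMean x - u‖ ^ 2
      - η * (globalObj D f (clientMean x) - Fstar) + 2 * η * (globalObj D f u - Fstar)
      + 3 * η * H * consensusError x + η ^ 2 * (σ ^ 2 / M) := by
    have h1 := measurable_clientMean (M := M) (d := d)
    have h2 := measurable_consensusError (M := M) (d := d)
    have h3 := hF.continuous.measurable
    fun_prop
  have hi1 := (hi k hk.le).sub hiF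
  have hi2 := hi1.add (integrable_const (μ := P) (2 * η * (globalObj D f u - Fstar)))
  have hi3 := hi2.add hiV
  have hi4 := hi3.add (integrable_const (μ := P) (η ^ 2 * (σ ^ 2 / M)))
  have key := integral_le_of_indepFun (h.measurable_clients w₀ hr hk.le)
      (h.measurable_samples hr hk) (h.indepFun_clients w₀ hr hk) hstep (hi (k + 1) hk) hb hi4
      (fun x => by
        rw [map_samples h.sampling hr hk]
        exact integral_norm_clientMean_clientStep_sq_le h.common h.noise h.clients_pos
          h.smooth_pos h.step_pos.le h.step_le x u)
  have e := integral_add hi3 (integrable_const (μ := P) (η ^ 2 * (σ ^ 2 / M)))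
  rw [integral_add' hi2 hiV, integral_add' hi1 (integrable_const _), integral_sub' (hi k hk.le) hiF,
    integral_const, integral_const, probReal_univ, one_smul, one_smul, integral_const_mul,
    integral_const_mul] at e
  refine (key.trans_eq e).trans ?_
  have hV := mul_le_mul_of_nonneg_left (h.integral_consensusError_le w₀ hr hk.le)
    (show 0 ≤ 3 * η * H by have := h.smooth_pos; have := h.step_pos; positivity)
  linarith

/-- The expected suboptimality of the averaged iterate. -/
theorem integral_localSGD_le (h : IsRun D f H Fstar σ ζ η K R P ξ) (w₀ u : Vec d) :
    Integrable (fun ω => globalObj D f (localSGD f η K R (fun _ _ => 1 / ((K : ℝ) * R))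
      (fun r k m => ξ r k m ω) w₀)) P ∧
    ∫ ω, (globalObj D f (localSGD f η K R (fun _ _ => 1 / ((K : ℝ) * R))
      (fun r k m => ξ r k m ω) w₀) - Fstar) ∂P ≤
      ‖w₀ - u‖ ^ 2 / (η * (K * R)) + 2 * (globalObj D f u - Fstar)
        + 3 * H * (24 * K ^ 2 * η ^ 2 * ζ ^ 2 + 12 * K * η ^ 2 * σ ^ 2) + η * (σ ^ 2 / M) := by
  have hK : (0 : ℝ) < K := by exact_mod_cast h.steps_pos
  have hR : (0 : ℝ) < R := by exact_mod_cast h.rounds_pos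
  have hη := h.step_pos
  have hF := h.common.globalObj_quadBounds h.clients_pos
  have hL : ∀ i ∈ Finset.range R ×ˢ Finset.range K, MemLp
      (fun ω => clientMean (clients f η K (fun r k m => ξ r k m ω) w₀ i.1 i.2)) 2 P := by
    intro i hi
    rw [Finset.mem_product, Finset.mem_range, Finset.mem_range] at hi
    exact memLp_clientMean (h.memLp_clients w₀ hi.1 i.2 hi.2.le)
  have hiF : ∀ i ∈ Finset.range R ×ˢ Finset.range K, Integrable
      (fun ω => globalObj D f (clientMean (clients f η K (fun r k m => ξ r k m ω) w₀ i.1 i.2))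
        - Fstar) P :=
    fun i hi => (hF.integrable_comp (hL i hi)).sub (integrable_const _)
  have hint : Integrable (fun ω => globalObj D f (localSGD f η K R
      (fun _ _ => 1 / ((K : ℝ) * R)) (fun r k m => ξ r k m ω) w₀)) P := by
    refine hF.integrable_comp ?_
    simp only [localSGD_eq]
    exact memLp_finsetSum _ fun i hi => (hL i hi).const_smul (1 / ((K : ℝ) * R))
  refine ⟨hint, ?_⟩
  have hw : ∑ _i ∈ Finset.range R ×ˢ Finset.range K, 1 / ((K : ℝ) * R) = 1 := by
    simp; field_simp
  have hjensen : ∀ ω, globalObj D f (localSGD f η K R (fun _ _ => 1 / ((K : ℝ) * R))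
      (fun r k m => ξ r k m ω) w₀) - Fstar ≤ ∑ i ∈ Finset.range R ×ˢ Finset.range K,
        1 / ((K : ℝ) * R) * (globalObj D f
          (clientMean (clients f η K (fun r k m => ξ r k m ω) w₀ i.1 i.2)) - Fstar) := by
    intro ω
    have h1 := hF.convexOn.map_sum_le (t := Finset.range R ×ˢ Finset.range K)
      (w := fun _ => 1 / ((K : ℝ) * R))
      (p := fun i => clientMean (clients f η K (fun r k m => ξ r k m ω) w₀ i.1 i.2))
      (fun _ _ => by positivity) hw (fun _ _ => Set.mem_univ _)
    rw [localSGD_eq]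
    simp_rw [mul_sub]
    rw [Finset.sum_sub_distrib, ← Finset.sum_mul, hw, one_mul]
    simpa using h1
  set Φ : ℕ → ℕ → ℝ := fun r k =>
    ∫ ω, ‖clientMean (clients f η K (fun r k m => ξ r k m ω) w₀ r k) - u‖ ^ 2 ∂P with hΦ
  set e : ℕ → ℕ → ℝ := fun r k => ∫ ω, (globalObj D f
    (clientMean (clients f η K (fun r k m => ξ r k m ω) w₀ r k)) - Fstar) ∂P with he
  set c : ℝ := 2 * η * (globalObj D f u - Fstar)
        + 3 * η * H * (24 * K ^ 2 * η ^ 2 * ζ ^ 2 + 12 * K * η ^ 2 * σ ^ 2)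
        + η ^ 2 * (σ ^ 2 / M) with hc
  have hstep : ∀ r < R, ∀ k < K, η * e r k ≤ Φ r k - Φ r (k + 1) + c := by
    intro r hr k hk
    have := h.integral_norm_mean_succ_le w₀ u hr hk
    simp only [hΦ, he]
    linarith
  have hround : ∀ r < R, ∑ k ∈ Finset.range K, η * e r k ≤ Φ r 0 - Φ (r + 1) 0 + K * c := by
    intro r hr
    have h1 := Finset.sum_le_sum fun k hk => hstep r hr k (Finset.mem_range.1 hk)
    rw [Finset.sum_add_distrib, Finset.sum_range_sub'] at h1
    -- Averaging preserves the client mean, so the potential telescopes across round boundaries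
    -- without loss.
    have h2 : Φ (r + 1) 0 = Φ r K := by
      simp only [hΦ, clients_zero, clientMean_const h.clients_pos]
    rw [h2]
    simpa using h1
  have htotal : ∑ r ∈ Finset.range R, ∑ k ∈ Finset.range K, η * e r k ≤
      ‖w₀ - u‖ ^ 2 + R * (K * c) := by
    have h1 := Finset.sum_le_sum fun r hr => hround r (Finset.mem_range.1 hr)
    rw [Finset.sum_add_distrib, Finset.sum_range_sub'] at h1
    have h2 : Φ 0 0 = ‖w₀ - u‖ ^ 2 := by
      simp [hΦ, clients_zero_zero, clientMean_const h.clients_pos]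
    have h3 : 0 ≤ Φ R 0 := integral_nonneg fun _ => by positivity
    simp only [Finset.sum_const, Finset.card_range, nsmul_eq_mul] at h1
    linarith
  have hE : ∫ ω, (globalObj D f (localSGD f η K R (fun _ _ => 1 / ((K : ℝ) * R))
      (fun r k m => ξ r k m ω) w₀) - Fstar) ∂P ≤
      1 / ((K : ℝ) * R) * ∑ r ∈ Finset.range R, ∑ k ∈ Finset.range K, e r k := by
    refine (integral_mono (hint.sub (integrable_const _)) (integrable_finsetSum _ fun i hi =>
      (hiF i hi).const_mul _) hjensen).trans_eq ?_
    rw [integral_finsetSum _ fun i hi => (hiF i hi).const_mul _, ← Finset.sum_product',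
      Finset.mul_sum]
    exact Finset.sum_congr rfl fun i _ => integral_const_mul _ _
  simp_rw [← Finset.mul_sum] at htotal
  refine hE.trans ?_
  have h4 : ∑ r ∈ Finset.range R, ∑ k ∈ Finset.range K, e r k ≤
      (‖w₀ - u‖ ^ 2 + R * (K * c)) / η := by
    rw [le_div_iff₀ hη]; linarith
  refine (mul_le_mul_of_nonneg_left h4 (by positivity)).trans_eq ?_
  rw [hc]
  field_simp
  ring

end IsRun

end Run

end LocalSGD

/-! ### Step size, the zero-step run and measurable versions of the samples -/

namespace LocalSGD

/-- Choice of the step size balancing the four error terms. -/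
theorem exists_stepSize {q H S A B a b s : ℝ} (hq : 0 < q) (hH : 0 < H) (hS : 0 ≤ S) (hA : 0 ≤ A)
    (hB : 0 ≤ B) (hSs : S ^ 2 = s * q) (hAa : A ^ 3 = a * q ^ 2) (hBb : B ^ 3 = b * q ^ 2) :
    ∃ η : ℝ, 0 < η ∧ η * (8 * H) ≤ 1 ∧
      q / η + 72 * a * η ^ 2 + 36 * b * η ^ 2 + s * η ≤ 73 * (H * q + S + A + B) := by
  set T := 8 * (H * q) + S + A + B with hT
  have hHq : 0 < H * q := by positivity
  have hTpos : 0 < T := by positivity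
  -- With η = q / T one has q / η = T. The 8Hq in `T` enforces 8ηH ≤ 1; aη² = A³ / T² ≤ A, likewise
  -- for `B`, and sη = S² / T ≤ S. The largest total coefficient is 72 + 1.
  refine ⟨q / T, by positivity, ?_, ?_⟩
  · rw [div_mul_eq_mul_div, div_le_one hTpos]; linarith
  · have cube : ∀ {X x : ℝ}, 0 ≤ X → X ≤ T → X ^ 3 = x * q ^ 2 → x * (q / T) ^ 2 ≤ X := by
      intro X x h0 hXT hx
      rw [div_pow, mul_div_assoc', ← hx, div_le_iff₀ (by positivity), pow_succ' X 2]
      gcongr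
    have h1 : q / (q / T) = T := by field_simp
    have h2 := cube hA (by linarith) hAa
    have h3 := cube hB (by linarith) hBb
    have h4 : s * (q / T) ≤ S := by
      rw [mul_div_assoc', ← hSs, div_le_iff₀ hTpos, sq]
      exact mul_le_mul_of_nonneg_left (by linarith) hS
    rw [h1]
    linarith

theorem rpow_one_third_pow_three {x : ℝ} (hx : 0 ≤ x) : (x ^ (1 / 3 : ℝ)) ^ 3 = x := by
  rw [← Real.rpow_natCast, ← Real.rpow_mul hx]; norm_num

theorem rpow_two_thirds_pow_three {x : ℝ} (hx : 0 ≤ x) : (x ^ (2 / 3 : ℝ)) ^ 3 = x ^ 2 := by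
  rw [← Real.rpow_natCast, ← Real.rpow_mul hx, ← Real.rpow_natCast]; norm_num

variable {d M K R : ℕ} {Ξ : Type*} {f : Vec d → Ξ → ℝ}

theorem clients_zero_step (hM : 0 < M) (s : ℕ → ℕ → Fin M → Ξ) (w₀ : Vec d) (r : ℕ) :
    ∀ k, clients f 0 K s w₀ r k = fun _ => w₀ := by
  have hround : ∀ r, clients f 0 K s w₀ r 0 = (fun _ => w₀) →
      ∀ k, clients f 0 K s w₀ r k = fun _ => w₀ := by
    intro r h0 k
    induction k with
    | zero => exact h0
    | succ k ih =>
      rw [clients_succ, ih]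
      funext m
      simp [clientStep]
  induction r with
  | zero => exact hround 0 (clients_zero_zero s w₀)
  | succ r ih =>
    refine hround (r + 1) ?_
    rw [clients_zero, ih, clientMean_const hM]

theorem localSGD_zero_step (hM : 0 < M) (hK : 0 < K) (hR : 0 < R) (s : ℕ → ℕ → Fin M → Ξ)
    (w₀ : Vec d) : localSGD f 0 K R (fun _ _ => 1 / ((K : ℝ) * R)) s w₀ = w₀ := by
  have hK' : (0 : ℝ) < K := by exact_mod_cast hK
  have hR' : (0 : ℝ) < R := by exact_mod_cast hR
  rw [localSGD_eq]
  simp only [clients_zero_step hM, clientMean_const hM]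
  rw [← Finset.sum_smul]
  have : ∑ _i ∈ Finset.range R ×ˢ Finset.range K, 1 / ((K : ℝ) * R) = 1 := by
    simp; field_simp
  rw [this, one_smul]

section Samples

variable {Ω : Type*} [MeasurableSpace Ξ] [MeasurableSpace Ω] {D : Fin M → Measure Ξ} {P : Measure Ω}
  {ξ : ℕ → ℕ → Fin M → Ω → Ξ}

/-- Samples can be modified on a null set to be measurable. -/
theorem IsSampling.exists_measurable (h : IsSampling K R D P ξ) :
    ∃ ξ' : ℕ → ℕ → Fin M → Ω → Ξ, IsSampling K R D P ξ' ∧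
      (∀ r < R, ∀ k < K, ∀ m, Measurable (ξ' r k m)) ∧
      ∀ᵐ ω ∂P, (fun r k m => ξ r k m ω) = fun r k m => ξ' r k m ω := by
  classical
  let ξ' : ℕ → ℕ → Fin M → Ω → Ξ := fun r k m =>
    if hrk : r < R ∧ k < K then (h.1 r hrk.1 k hrk.2 m).aemeasurable.mk else ξ r k m
  have hae : ∀ r k m, ξ r k m =ᵐ[P] ξ' r k m := by
    intro r k m
    by_cases hrk : r < R ∧ k < K
    · simp only [ξ', dif_pos hrk]
      exact (h.1 r hrk.1 k hrk.2 m).aemeasurable.ae_eq_mk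
    · simp only [ξ', dif_neg hrk]
      exact Filter.EventuallyEq.rfl
  refine ⟨ξ', ⟨fun r hr k hk m => (h.1 r hr k hk m).congr (hae r k m).symm,
    h.2.congr fun i => hae _ _ _⟩, fun r hr k hk m => ?_, ?_⟩
  · simp only [ξ', dif_pos (And.intro hr hk)]
    exact (h.1 r hr k hk m).aemeasurable.measurable_mk
  · have := ae_all_iff.2 fun r => ae_all_iff.2 fun k => ae_all_iff.2 fun m => hae r k m
    filter_upwards [this] with ω hω
    exact funext fun r => funext fun k => funext fun m => hω r k m

end Samples

end LocalSGD

theorem theorem4 :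
    ∃ C : ℝ, 0 < C ∧
      ∀ (d M K R : ℕ), 0 < M → 0 < K → 0 < R →
      ∀ (Ξ : Type*) [MeasurableSpace Ξ] (D : Fin M → Measure Ξ) [∀ m, IsProbabilityMeasure (D m)]
        (f : LocalSGD.Vec d → Ξ → ℝ) (H σ ζ Fstar : ℝ), 0 ≤ H → 0 ≤ σ → 0 ≤ ζ →
        LocalSGD.CommonAssumption D f H Fstar →
        LocalSGD.GlobalNoise D f σ →
        LocalSGD.GlobalHeterogeneity D f ζ →
      ∀ (w₀ u : LocalSGD.Vec d),
        ∃ η : ℝ, 0 ≤ η ∧ (w₀ ≠ u → 0 < η) ∧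
          ∀ (Ω : Type*) [MeasurableSpace Ω] (P : Measure Ω) [IsProbabilityMeasure P]
            (ξ : ℕ → ℕ → Fin M → Ω → Ξ), LocalSGD.IsSampling K R D P ξ →
            Integrable (fun ω => LocalSGD.globalObj D f
              (LocalSGD.localSGD f η K R (fun _ _ => 1 / ((K : ℝ) * R))
                (fun r k m => ξ r k m ω) w₀)) P ∧
            ∫ ω, (LocalSGD.globalObj D f
              (LocalSGD.localSGD f η K R (fun _ _ => 1 / ((K : ℝ) * R))
                (fun r k m => ξ r k m ω) w₀) - Fstar) ∂P ≤
              C * (H * ‖w₀ - u‖ ^ 2 / (K * R)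
                + σ * ‖w₀ - u‖ / √(M * K * R)
                + (H * ζ ^ 2 * ‖w₀ - u‖ ^ 4) ^ (1 / 3 : ℝ) / (R : ℝ) ^ (2 / 3 : ℝ)
                + (H * σ ^ 2 * ‖w₀ - u‖ ^ 4) ^ (1 / 3 : ℝ)
                    / ((K : ℝ) ^ (1 / 3 : ℝ) * (R : ℝ) ^ (2 / 3 : ℝ))
                + (LocalSGD.globalObj D f u - Fstar)) := by
  -- The constant of `exists_stepSize`, which also dominates the coefficient 2 of the comparator's
  -- suboptimality.
  refine ⟨73, by norm_num, ?_⟩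
  intro d M K R hM hK hR Ξ _ D _ f H σ ζ Fstar hH hσ hζ hA hN hZ w₀ u
  have hM' : (0 : ℝ) < M := by exact_mod_cast hM
  have hK' : (0 : ℝ) < K := by exact_mod_cast hK
  have hR' : (0 : ℝ) < R := by exact_mod_cast hR
  have hu : 0 ≤ LocalSGD.globalObj D f u - Fstar := sub_nonneg.2 (hA.lower_bound u)
  have hF := hA.globalObj_quadBounds hM
  have trivial_case : ∀ {t : ℝ}, 0 ≤ t → LocalSGD.globalObj D f u - Fstar ≤
      73 * (t + (LocalSGD.globalObj D f u - Fstar)) := fun ht => by linarith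
  by_cases hw : w₀ = u
  -- With step size 0 the output stays at `w₀ = u`, and the comparator term alone covers its
  -- suboptimality.
  · subst hw
    refine ⟨0, le_rfl, fun h => absurd rfl h, ?_⟩
    intro Ω _ P _ ξ hξ
    simp only [LocalSGD.localSGD_zero_step hM hK hR]
    refine ⟨integrable_const _, ?_⟩
    rw [integral_const, probReal_univ, one_smul]
    exact trivial_case (by positivity)
  rcases hH.eq_or_lt with rfl | hHpos
  -- For H = 0 the objective is affine and bounded below, hence constant; any step size serves.
  · rw [mul_zero] at hF
    have hconst : ∀ w, LocalSGD.globalObj D f w = LocalSGD.globalObj D f u :=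
      fun w => hF.eq_of_lower_bound hA.lower_bound w u
    refine ⟨1, zero_le_one, fun _ => one_pos, ?_⟩
    intro Ω _ P _ ξ hξ
    simp only [hconst (LocalSGD.localSGD _ _ _ _ _ _ _)]
    refine ⟨integrable_const _, ?_⟩
    rw [integral_const, probReal_univ, one_smul]
    exact trivial_case (by positivity)
  have hB : 0 < ‖w₀ - u‖ := norm_pos_iff.2 (sub_ne_zero.2 hw)
  set B := ‖w₀ - u‖ with hBdef
  -- Here q = B² / (KR); `a`, `b`, `s` are the coefficients in `integral_localSGD_le`, since
  -- 3H·24K²ζ² = 72a and 3H·12Kσ² = 36b. The choice of `η` precedes the probability space.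
  obtain ⟨η, hη, hηH, hbound⟩ := LocalSGD.exists_stepSize (q := B ^ 2 / (K * R)) (H := H)
    (S := σ * B / √(M * K * R))
    (A := (H * ζ ^ 2 * B ^ 4) ^ (1 / 3 : ℝ) / (R : ℝ) ^ (2 / 3 : ℝ))
    (B := (H * σ ^ 2 * B ^ 4) ^ (1 / 3 : ℝ) / ((K : ℝ) ^ (1 / 3 : ℝ) * (R : ℝ) ^ (2 / 3 : ℝ)))
    (s := σ ^ 2 / M) (a := H * K ^ 2 * ζ ^ 2) (b := H * K * σ ^ 2)
    (by positivity) hHpos (by positivity) (by positivity) (by positivity)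
    (by rw [div_pow, Real.sq_sqrt (by positivity)]; field_simp)
    (by
      rw [div_pow, LocalSGD.rpow_one_third_pow_three (by positivity),
        LocalSGD.rpow_two_thirds_pow_three hR'.le]
      field_simp)
    (by
      rw [div_pow, mul_pow, LocalSGD.rpow_one_third_pow_three (by positivity),
        LocalSGD.rpow_one_third_pow_three hK'.le, LocalSGD.rpow_two_thirds_pow_three hR'.le]
      field_simp)
  refine ⟨η, hη.le, fun _ => hη, ?_⟩
  intro Ω _ P _ ξ hξ
  -- Laws only give almost-everywhere measurability; the outputs for `ξ` and `ξ'` agree almost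
  -- surely.
  obtain ⟨ξ', hξ', hmeas, hae⟩ := hξ.exists_measurable
  have hrun : LocalSGD.IsRun D f H Fstar σ ζ η K R P ξ' :=
    ⟨hA, hN, hZ, hmeas, hξ', hM, hK, hR, hHpos, hη, hηH⟩
  obtain ⟨hint, hle⟩ := hrun.integral_localSGD_le w₀ u
  have hae' : ∀ᵐ ω ∂P, LocalSGD.globalObj D f (LocalSGD.localSGD f η K R
      (fun _ _ => 1 / ((K : ℝ) * R)) (fun r k m => ξ' r k m ω) w₀) =
      LocalSGD.globalObj D f (LocalSGD.localSGD f η K R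
      (fun _ _ => 1 / ((K : ℝ) * R)) (fun r k m => ξ r k m ω) w₀) := by
    filter_upwards [hae] with ω hω
    rw [hω]
  refine ⟨hint.congr hae', ?_⟩
  rw [← integral_congr_ae (hae'.mono fun ω hω => congrArg (· - Fstar) hω)]
  refine hle.trans ?_
  have e : B ^ 2 / (η * (K * R)) = B ^ 2 / (K * R) / η := by field_simp
  have e' : H * (B ^ 2 / (K * R)) = H * B ^ 2 / (K * R) := by ring
  rw [e'] at hbound
  rw [← hBdef, e]
  linarith
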